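/- **Setting.** Let $C$ be a compact complex manifold of dimension $n$, covered by finitely many coordinate charts $(U_j,h_j)$ biholomorphic to polydiscs, with transition functions $h_k=\varphi_{kj}(h_j)$. Let $N_C$ be a holomorphic vector bundle of rank $d$ on $C$ with transition matrices $t_{kj}$ and fibre coordinates $v_j$, and let $T_CM$ be an extension of $N_C$ by $TC$ with transition matrices $g_{kj}=\begin{pmatrix}s_{kj}&l_{kj}\\0&t_{kj}\end{pmatrix}$, where $s_{kj}$ is the Jacobian matrix of $\varphi_{kj}$; if $T_CM$ splits, the frames are chosen with $l_{kj}=0$. A *formal neighborhood* of $C$ (with this $T_CM$) is a family $\Phi=\{\Phi_{kj}\}$ of formal power series in $v_j$, with holomorphic coefficients on $U_k\cap U_j$, $$\Phi_{kj}(h_j,v_j)=(\Phi^h_{kj},\Phi^v_{kj})=(\varphi_{kj}(h_j)+l_{kj}(h_j)v_j,\ t_{kj}(h_j)v_j)+O(2),\qquad \Phi_{kj}\circ\Phi_{ji}=\Phi_{ki},$$ where $O(m)$ denotes terms of order $\ge m$ in $v$. It is a *holomorphic neighborhood* if the series converge near $C$. Let $\mathcal M$ be either the set of all holomorphic or the set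 of all formal neighborhoods. Let $\mathcal T$ be the set of formal maps $F=\{F_j\}$, $F_j(h_j,v_j)=(h_j,v_j)+O(2)$, given by power series in $v_j$ with holomorphic coefficients on $U_j$. Call $\Phi$ *foliated* if $\Phi^h_{kj}(h_j,v_j)=\varphi_{kj}(h_j)$ for all $k,j$. Say that $\Phi$ *admits a formal transverse foliation* if there are formal power series $H_j(h_j,v_j)=h_j+O(2)\in\mathbb C^n$ in $v_j$, with holomorphic coefficients on $U_j$, such that $H_k\circ\Phi_{kj}=\varphi_{kj}\circ H_j$ for all $k,j$ (the leaves $H_j=\mathrm{const}$ are then transverse to $C$, and tangent along $C$ to the summand $N_C$ of $T_CM=TC\oplus N_C$). **Normal forms.** For each $m\ge2$ fix cocycles $e^m=(e^m_1,\dots,e^m_{k_m})$ representing a basis of $H^1(C,T_CM\otimes S^mN_C^*)$ (identified with families of homogeneous polynomials of degree $m$ in $v_j$ with values in $\mathbb C^{n+d}$); if $l_{kj}=0$ for all $k,j$, each $e^m_i$ is chosen with values in $TC\otimes S^mN_C^*$ or in $N_C\otimes S^mN_C^*$. For $\Phi\in\mathcal M$ put $\operatorname{Aut}_m(\Phi)=\{F\in\mathcal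 T: F\Phi F^{-1}=\Phi+O(m+1)\}$ and $\mathcal M_m(\Phi)=\{\tilde\Phi\in\mathcal M:\tilde\Phi=\Phi+c^m\cdot e^m+O(m+1)\text{ for some }c^m\in\mathbb C^{k_m}\}$; elements $\Psi,\tilde\Psi$ of $\mathcal M_m(\Phi)$ are equivalent if $F\Psi F^{-1}=\tilde\Psi+O(m+1)$ for some $F\in\operatorname{Aut}_m(\Phi)$. Starting from a fixed $N^1\in\mathcal M$, let partial normal forms be chosen inductively: for $m\ge2$ and each chosen $N^{m-1}=N^{m-1}(c^2,\dots,c^{m-1})$, each equivalence class of $\mathcal M_m(N^{m-1})$ has exactly one chosen representative $$N^m(c^2,\dots,c^m)=N^{m-1}(c^2,\dots,c^{m-1})+c^m\cdot e^m+O(m+1)\in\mathcal M ,$$ with $N^m(c^2,\dots,c^{m-1},0)=N^{m-1}(c^2,\dots,c^{m-1})$. The choice is made so that, for every $m\ge1$, $N^m(c^2,\dots,c^m)$ is foliated whenever some foliated formal neighborhood is equal to $F\,N^m(c^2,\dots,c^m)\,F^{-1}+O(m+1)$ for some $F\in\operatorname{Aut}_m(N^m(c^2,\dots,c^m))$. **Proposition.**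 Let $\ell_0>1$ be an integer such that $H^1(C,T_CM\otimes S^\ell N_C^*)=0$ for all $\ell>\ell_0$. Then $\Phi\in\mathcal M$ admits a formal transverse foliation if and only if there are a formal map $F\in\mathcal T$ and a chosen partial normal form $N^{\ell_0}(c^2,\dots,c^{\ell_0})$ such that $$F\Phi F^{-1}=N^{\ell_0}(c^2,\dots,c^{\ell_0})+O(\ell_0+1)\quad\text{and}\quad \bigl(N^{\ell_0}(c^2,\dots,c^{\ell_0})\bigr)^h_{kj}=\varphi_{kj}(h_j)\ \text{ for all } k,j .$$ -/

import Mathlib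

open scoped Manifold ContDiff Topology
open Asymptotics

noncomputable section

namespace TransFol

/-- A formal power series `∑ a_Q(h) v^Q` in `v ∈ ℂ^d` whose coefficients are functions of
`h ∈ ℂ^n` with values in `E`.  The coefficients are total functions; only their values on the
coordinate domain that goes with the series are ever used. -/
abbrev Series (n d : ℕ) (E : Type*) := (Fin d → ℕ) → (Fin n → ℂ) → E

/-- The coordinate space `ℂ^n × ℂ^d` of the pairs `(h, v)` (horizontal, vertical). -/
abbrev HV (n d : ℕ) := (Fin n → ℂ) × (Fin d → ℂ)

/-- `[a]^m (h, v) = ∑_{|Q| = m} a_Q(h) v^Q`. -/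
def Series.part {n d : ℕ} {E : Type*} [AddCommMonoid E] [Module ℂ E] (a : Series n d E) (m : ℕ)
    (h : Fin n → ℂ) (v : Fin d → ℂ) : E :=
  ∑ Q ∈ Finset.piAntidiag (Finset.univ : Finset (Fin d)) m, (∏ i, v i ^ Q i) • a Q h

/-- `[a]^{≤ m} (h, v)`, the sum of the terms of degree at most `m` in `v`: an actual map. -/
def Series.trunc {n d : ℕ} {E : Type*} [AddCommMonoid E] [Module ℂ E] (a : Series n d E) (m : ℕ)
    (x : HV n d) : E :=
  ∑ q ∈ Finset.range (m + 1), a.part q x.1 x.2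

/-- `f = g + O(|v|^{m+1})` near the point `(p, 0)`. -/
def EqNear {n d : ℕ} {E : Type*} [NormedAddCommGroup E] (m : ℕ) (p : Fin n → ℂ)
    (f g : HV n d → E) : Prop :=
  (fun x => f x - g x) =O[𝓝 (p, (0 : Fin d → ℂ))] fun x => ‖x.2‖ ^ (m + 1)

/-- A covering of the complex manifold `C` by holomorphic coordinate charts `U_j` which
are biholomorphic to polydiscs (hence a Leray covering). -/
structure Cover (n : ℕ) (C : Type*) [TopologicalSpace C] [ChartedSpace (Fin n → ℂ) C]
    (ι : Type*) where
  chart : ι → OpenPartialHomeomorph C (Fin n → ℂ)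
  chart_mem : ∀ j, chart j ∈ IsManifold.maximalAtlas 𝓘(ℂ, Fin n → ℂ) ω C
  covers : ∀ x, ∃ j, x ∈ (chart j).source
  polydisc : ∀ j, ∃ (a : Fin n → ℂ) (r : Fin n → ℝ),
    (chart j).target = Set.univ.pi fun i => Metric.ball (a i) (r i)

namespace Cover

variable {n : ℕ} {C : Type*} [TopologicalSpace C] [ChartedSpace (Fin n → ℂ) C] {ι : Type*}
  (U : Cover n C ι)

/-- The transition function `h_k = φ_{kj}(h_j)` of `C`. -/
def φ (k j : ι) : (Fin n → ℂ) → (Fin n → ℂ) := (U.chart j).symm.trans (U.chart k)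

/-- `U_k ∩ U_j` in the coordinate `h_j`, the domain of `φ_{kj}`. -/
def dom (k j : ι) : Set (Fin n → ℂ) := ((U.chart j).symm.trans (U.chart k)).source

/-- `U_j` in the coordinate `h_j`. -/
def img (j : ι) : Set (Fin n → ℂ) := (U.chart j).target

/-- `U_k ∩ U_j ∩ U_i` in the coordinate `h_i`. -/
def dom₃ (k j i : ι) : Set (Fin n → ℂ) := U.dom k i ∩ U.dom j i

end Cover

/-- The bundle `T_C M`, given by the holomorphic transition matrices
`g_{kj} = (s_{kj}, l_{kj}; 0, t_{kj})`, where `s_{kj}` is the Jacobian matrix of `φ_{kj}` and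
`t_{kj}` are the transition matrices of the normal bundle `N_C`.  If the bundle splits then the
frames are chosen with `l_{kj} = 0`. -/
structure TangentBundleData {n : ℕ} {C : Type*} [TopologicalSpace C]
    [ChartedSpace (Fin n → ℂ) C] {ι : Type*} (U : Cover n C ι) (d : ℕ) where
  l : ι → ι → (Fin n → ℂ) → Matrix (Fin n) (Fin d) ℂ
  t : ι → ι → (Fin n → ℂ) → Matrix (Fin d) (Fin d) ℂ
  l_hol : ∀ k j a b, AnalyticOnNhd ℂ (fun h => l k j h a b) (U.dom k j)
  t_hol : ∀ k j a b, AnalyticOnNhd ℂ (fun h => t k j h a b) (U.dom k j)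
  t_self : ∀ j, ∀ h ∈ U.img j, t j j h = 1
  t_cocycle : ∀ k j i, ∀ h ∈ U.dom₃ k j i, t k i h = t k j (U.φ j i h) * t j i h
  l_cocycle : ∀ k j i, ∀ h ∈ U.dom₃ k j i, ∀ y,
    (l k i h).mulVec y = fderiv ℂ (U.φ k j) (U.φ j i h) ((l j i h).mulVec y)
      + (l k j (U.φ j i h)).mulVec ((t j i h).mulVec y)
  -- a holomorphic splitting is a complement of `TC`, locally the graph of `a_j`
  l_eq_zero_of_splits :
    (∃ a : ι → (Fin n → ℂ) → Matrix (Fin n) (Fin d) ℂ,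
      (∀ j α β, AnalyticOnNhd ℂ (fun h => a j h α β) (U.img j)) ∧
      ∀ k j, ∀ h ∈ U.dom k j, ∀ y,
        fderiv ℂ (U.φ k j) h ((a j h).mulVec y) + (l k j h).mulVec y
          = (a k (U.φ k j h)).mulVec ((t k j h).mulVec y)) →
    ∀ k j, ∀ h ∈ U.dom k j, l k j h = 0

namespace TangentBundleData

variable {n d : ℕ} {C : Type*} [TopologicalSpace C] [ChartedSpace (Fin n → ℂ) C] {ι : Type*}
  {U : Cover n C ι} (T : TangentBundleData U d)

/-- The transition matrix `g_{kj}(h)` of `T_C M`, as a linear map. -/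
def g (k j : ι) (h : Fin n → ℂ) : HV n d →ₗ[ℂ] HV n d where
  toFun x := (fderiv ℂ (U.φ k j) h x.1 + (T.l k j h).mulVec x.2, (T.t k j h).mulVec x.2)
  map_add' x y := by
    ext
    · simp [Matrix.mulVec_add]
      ring
    · simp [Matrix.mulVec_add]
  map_smul' c x := by
    ext <;> simp [Matrix.mulVec_smul]

/-! ### Čech cohomology of `T_C M ⊗ S^m N_C^*` -/

/-- A Čech `1`-cochain: on `U_k ∩ U_j`, the section `∑_{|Q| = m} a_Q e_k ⊗ (w_j^*)^Q` is written as
the polynomial `∑_{|Q| = m} a_Q(h_j) v_j^Q`. -/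
abbrev Cochain (n d : ℕ) (ι : Type*) := ι → ι → Series n d (HV n d)

theorem part_add {n d : ℕ} (a b : Series n d (HV n d)) (m : ℕ) (h v) :
    Series.part (a + b) m h v = a.part m h v + b.part m h v := by
  simp [Series.part, smul_add, Finset.sum_add_distrib]

theorem part_smul {n d : ℕ} (c : ℂ) (a : Series n d (HV n d)) (m : ℕ) (h v) :
    Series.part (c • a) m h v = c • a.part m h v := by
  simp only [Series.part, Pi.smul_apply, Finset.smul_sum]
  exact Finset.sum_congr rfl fun Q _ => smul_comm _ _ _

theorem part_zero {n d : ℕ} (m : ℕ) (h v) :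
    Series.part (0 : Series n d (HV n d)) m h v = 0 := by
  simp [Series.part]

/-- The `1`-cocycles of degree `m`: `ψ_{ki} = ψ_{kj} + ψ_{ji}` as sections, that is
`ψ_{ki}(h_i, v_i) = ψ_{kj}(N_{ji}(h_i, v_i)) + g_{kj} ψ_{ji}(h_i, v_i)`. -/
def Z1 (m : ℕ) : Submodule ℂ (Cochain n d ι) where
  carrier := {ψ |
    (∀ k j Q, ∑ i, Q i = m → AnalyticOnNhd ℂ (ψ k j Q) (U.dom k j)) ∧
    ∀ k j i, ∀ h ∈ U.dom₃ k j i, ∀ v,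
      (ψ k i).part m h v = (ψ k j).part m (U.φ j i h) ((T.t j i h).mulVec v)
        + T.g k j (U.φ j i h) ((ψ j i).part m h v)}
  add_mem' := by
    rintro a b ⟨ha, ha'⟩ ⟨hb, hb'⟩
    refine ⟨fun k j Q hQ => (ha k j Q hQ).add (hb k j Q hQ), fun k j i h hh v => ?_⟩
    simp only [Pi.add_apply, part_add, map_add, ha' k j i h hh v, hb' k j i h hh v]
    abel
  zero_mem' :=
    ⟨fun _ _ _ _ => analyticOnNhd_const, fun k j i h _ v => by simp [part_zero]⟩
  smul_mem' := by
    rintro c a ⟨ha, ha'⟩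
    refine ⟨fun k j Q hQ => (ha k j Q hQ).const_smul (c := c), fun k j i h hh v => ?_⟩
    simp only [Pi.smul_apply, part_smul, map_smul, ha' k j i h hh v, smul_add]

/-- The `1`-coboundaries of degree `m`:
`(δ f)_{kj}(h_j, v_j) = g_{kj} f_j(h_j, v_j) - f_k(N_{kj}(h_j, v_j))`. -/
def B1 (m : ℕ) : Submodule ℂ (Cochain n d ι) where
  carrier := {ψ | ∃ f : ι → Series n d (HV n d),
    (∀ j Q, ∑ i, Q i = m → AnalyticOnNhd ℂ (f j Q) (U.img j)) ∧
    ∀ k j, ∀ h ∈ U.dom k j, ∀ v,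
      (ψ k j).part m h v = T.g k j h ((f j).part m h v)
        - (f k).part m (U.φ k j h) ((T.t k j h).mulVec v)}
  add_mem' := by
    rintro a b ⟨f, hf, ha⟩ ⟨f', hf', hb⟩
    refine ⟨f + f', fun j Q hQ => (hf j Q hQ).add (hf' j Q hQ), fun k j h hh v => ?_⟩
    simp only [Pi.add_apply, part_add, map_add, ha k j h hh v, hb k j h hh v]
    abel
  zero_mem' :=
    ⟨0, fun _ _ _ => analyticOnNhd_const, fun k j h _ v => by simp [part_zero]⟩
  smul_mem' := by
    rintro c a ⟨f, hf, ha⟩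
    refine ⟨c • f, fun j Q hQ => (hf j Q hQ).const_smul (c := c), fun k j h hh v => ?_⟩
    simp only [Pi.smul_apply, part_smul, map_smul, ha k j h hh v, smul_sub]

/-- `H^1(C, T_C M ⊗ S^m N_C^*)`, computed with the Leray covering. -/
abbrev H1 (m : ℕ) : Type _ := T.Z1 m ⧸ (T.B1 m).submoduleOf (T.Z1 m)

/-! ### Neighborhoods of `C` and formal maps -/

/-- `Φ = Ψ + O(m + 1)`. -/
def EqMod (_T : TangentBundleData U d) (m : ℕ) (Φ Ψ : ι → ι → Series n d (HV n d)) : Prop :=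
  ∀ k j Q, ∑ i, Q i ≤ m → ∀ h ∈ U.dom k j, Φ k j Q h = Ψ k j Q h

/-- The formal neighborhoods of `C` with the given `T_C M`: families of formal power series
`Φ_{kj} = (φ_{kj}(h) + l_{kj}(h) v, t_{kj}(h) v) + O(2)` with holomorphic coefficients on
`U_k ∩ U_j` such that `Φ_{kj} ∘ Φ_{ji} = Φ_{ki}` to every order. -/
def formalNbhds : Set (ι → ι → Series n d (HV n d)) :=
  {Φ | (∀ k j Q, AnalyticOnNhd ℂ (Φ k j Q) (U.dom k j)) ∧
    (∀ k j, ∀ h ∈ U.dom k j, Φ k j 0 h = (U.φ k j h, 0) ∧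
      ∀ v, (Φ k j).part 1 h v = ((T.l k j h).mulVec v, (T.t k j h).mulVec v)) ∧
    ∀ k j i, ∀ p ∈ U.dom₃ k j i, ∀ m,
      EqNear m p (fun x => (Φ k j).trunc m ((Φ j i).trunc m x)) ((Φ k i).trunc m)}

/-- The (germs of) holomorphic neighborhoods of `C` with the given `T_C M`: near every point of
`U_k ∩ U_j` the series `Φ_{kj}` is the expansion in `v` of a holomorphic map. -/
def holNbhds : Set (ι → ι → Series n d (HV n d)) :=
  {Φ | Φ ∈ T.formalNbhds ∧
    ∀ k j, ∀ p ∈ U.dom k j, ∃ f : HV n d → HV n d, AnalyticAt ℂ f (p, 0) ∧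
      ∀ m, EqNear m p f ((Φ k j).trunc m)}

/-- The formal maps `F = {F_j}`, `F_j(h, v) = (h, v) + O(2)`, tangent to the identity along `C`. -/
def formalMaps (_T : TangentBundleData U d) : Set (ι → Series n d (HV n d)) :=
  {F | (∀ j Q, AnalyticOnNhd ℂ (F j Q) (U.img j)) ∧
    ∀ j, ∀ h ∈ U.img j, F j 0 h = (h, 0) ∧ ∀ v, (F j).part 1 h v = (0, v)}

/-- `F Φ F⁻¹ = Ψ + O(m + 1)`, written as `F_k ∘ Φ_{kj} = Ψ_{kj} ∘ F_j + O(m + 1)`. -/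
def ConjMod (_T : TangentBundleData U d) (m : ℕ) (F : ι → Series n d (HV n d))
    (Φ Ψ : ι → ι → Series n d (HV n d)) : Prop :=
  ∀ k j, ∀ p ∈ U.dom k j,
    EqNear m p (fun x => (F k).trunc m ((Φ k j).trunc m x))
      (fun x => (Ψ k j).trunc m ((F j).trunc m x))

/-- `Aut_m(Φ)`: the formal maps `F = I + O(2)` with `F Φ F⁻¹ = Φ + O(m + 1)`. -/
def Aut (m : ℕ) (Φ : ι → ι → Series n d (HV n d)) : Set (ι → Series n d (HV n d)) :=
  {F | F ∈ T.formalMaps ∧ T.ConjMod m F Φ Φ}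

/-! ### Transverse foliations -/

/-- The horizontal components of the transition functions are `φ_{kj}(h_j)`:
the coordinates `(h_j, v_j)` are foliated coordinates of the foliation `h_j = const`. -/
def IsFoliated (_T : TangentBundleData U d) (Φ : ι → ι → Series n d (HV n d)) : Prop :=
  ∀ k j, ∀ h ∈ U.dom k j, (Φ k j 0 h).1 = U.φ k j h ∧ ∀ Q, Q ≠ 0 → (Φ k j Q h).1 = 0

/-- `Φ` admits a formal transverse foliation: there are formal first integrals
`H_j(h, v) = h + O(2)` (the leaf through a point of `C` is labelled by that point, and is tangent
there to the fibre of `N_C`) such that `H_k = const` and `H_j = const` define the same foliation,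
that is `H_k ∘ Φ_{kj} = φ_{kj} ∘ H_j` to every order. -/
def AdmitsFormalTransverseFoliation (_T : TangentBundleData U d)
    (Φ : ι → ι → Series n d (HV n d)) : Prop :=
  ∃ H : ι → Series n d (Fin n → ℂ),
    (∀ j Q, AnalyticOnNhd ℂ (H j Q) (U.img j)) ∧
    (∀ j, ∀ h ∈ U.img j, H j 0 h = h ∧ ∀ v, (H j).part 1 h v = 0) ∧
    ∀ k j, ∀ p ∈ U.dom k j, ∀ m,
      EqNear m p (fun x => (H k).trunc m ((Φ k j).trunc m x))
        (fun x => U.φ k j ((H j).trunc m x))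

/-- For every `m ≥ 2`, cocycles `e^m_1, …, e^m_{dim m}` whose classes form a basis of
`H^1(C, T_C M ⊗ S^m N_C^*)`.  If `T_C M = TC ⊕ N_C` (so `l_{kj} = 0`), then each of them takes its
values in `TC ⊗ S^m N_C^*` or in `N_C ⊗ S^m N_C^*`. -/
structure CohomologyBasis where
  dim : ℕ → ℕ
  e : ∀ m, Fin (dim m) → T.Z1 m
  linearIndependent : ∀ m, 2 ≤ m →
    LinearIndependent ℂ fun i => ((T.B1 m).submoduleOf (T.Z1 m)).mkQ (e m i)
  span_eq_top : ∀ m, 2 ≤ m →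
    Submodule.span ℂ (Set.range fun i => ((T.B1 m).submoduleOf (T.Z1 m)).mkQ (e m i)) = ⊤
  adapted : (∀ k j, ∀ h ∈ U.dom k j, T.l k j h = 0) → ∀ m, 2 ≤ m → ∀ i,
    (∀ k j, ∀ h ∈ U.dom k j, ∀ v, (((e m i).1 k j).part m h v).2 = 0) ∨
    (∀ k j, ∀ h ∈ U.dom k j, ∀ v, (((e m i).1 k j).part m h v).1 = 0)

variable {T}

/-- A sequence of coefficient vectors `c^m ∈ ℂ^{dim m}`. -/
abbrev CohomologyBasis.Coeff (b : T.CohomologyBasis) : Type := ∀ m, Fin (b.dim m) → ℂ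

/-- `Φ + c^m · e^m`. -/
def CohomologyBasis.shift (b : T.CohomologyBasis) (m : ℕ) (Φ : ι → ι → Series n d (HV n d))
    (a : Fin (b.dim m) → ℂ) : ι → ι → Series n d (HV n d) :=
  fun k j Q h => Φ k j Q h + if ∑ i, Q i = m then ∑ i, a i • (b.e m i).1 k j Q h else 0

/-- `𝓜_m(Φ)`: the members of `𝓜` of the form `Φ + c^m · e^m + O(m + 1)`. -/
def CohomologyBasis.nbhdClass (b : T.CohomologyBasis) (𝓜 : Set (ι → ι → Series n d (HV n d))) (m : ℕ)
    (Φ : ι → ι → Series n d (HV n d)) : Set (ι → ι → Series n d (HV n d)) :=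
  {Ψ | Ψ ∈ 𝓜 ∧ ∃ a, T.EqMod m Ψ (b.shift m Φ a)}

/-- A choice of partial normal forms `N^m(c^2, …, c^m)`, `m ≥ 1`, for the set `𝓜` of neighborhoods.
`Adm m c` says that `(c^2, …, c^m)` is one of the parameters of the chosen normal forms. -/
structure NormalForms (b : T.CohomologyBasis) (𝓜 : Set (ι → ι → Series n d (HV n d))) where
  Adm : ℕ → b.Coeff → Prop
  N : ℕ → b.Coeff → ι → ι → Series n d (HV n d)
  /-- Only `c^2, …, c^m` matter. -/
  congr : ∀ m c c', (∀ q, 2 ≤ q → q ≤ m → c q = c' q) →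
    (Adm m c ↔ Adm m c') ∧ N m c = N m c'
  /-- `N^1` is always there. -/
  adm_one : ∀ c, Adm 1 c
  adm_pred : ∀ m c, 1 ≤ m → Adm (m + 1) c → Adm m c
  mem : ∀ m c, 1 ≤ m → Adm m c → N m c ∈ 𝓜
  /-- `N^m(c^2, …, c^m) = N^{m-1}(c^2, …, c^{m-1}) + c^m · e^m + O(m + 1)`. -/
  step : ∀ m c, 1 ≤ m → Adm (m + 1) c →
    T.EqMod (m + 1) (N (m + 1) c) (b.shift (m + 1) (N m c) (c (m + 1)))
  /-- Every element of `𝓜_m(N^{m-1}(c'))` is equivalent, under `Aut_m(N^{m-1}(c'))` and up to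
  `O(m + 1)`, to exactly one of the chosen representatives `N^m(c', c^m)`. -/
  represents : ∀ m c, 1 ≤ m → Adm m c → ∀ Ψ ∈ b.nbhdClass 𝓜 (m + 1) (N m c),
    ∃! a : Fin (b.dim (m + 1)) → ℂ, Adm (m + 1) (Function.update c (m + 1) a) ∧
      ∃ F ∈ T.Aut (m + 1) (N m c),
        T.ConjMod (m + 1) F Ψ (N (m + 1) (Function.update c (m + 1) a))
  /-- `N^m(c', 0) = N^{m-1}(c')`. -/
  stable : ∀ m c, 1 ≤ m → Adm m c → c (m + 1) = 0 →
    Adm (m + 1) c ∧ ∀ q, T.EqMod q (N (m + 1) c) (N m c)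
  /-- The representative is taken with horizontal components `φ_{kj}(h_j)` if its class contains
  a foliated (formal) neighborhood. -/
  foliated : ∀ m c, 1 ≤ m → Adm m c →
    (∃ Ψ ∈ T.formalNbhds, T.IsFoliated Ψ ∧ ∃ F ∈ T.Aut m (N m c), T.ConjMod m F (N m c) Ψ) →
    T.IsFoliated (N m c)

end TangentBundleData

end TransFol

end

/-!
A formal transverse foliation of `Φ` is the same thing as a conjugacy of `Φ`, by a formal map, to a
foliated neighborhood: if the `H_j` are first integrals then the maps `F_j = (H_j, v)` conjugate `Φ`
to a neighborhood with horizontal components `φ_{kj}` (`isFoliated_of_conj`), and the horizontal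
components of a map that conjugates `Φ` to a foliated neighborhood are first integrals
(`admits_of_conj`).  The theorem compares such conjugacies with conjugacies to partial normal forms,
degree by degree.

The mechanism is the usual one.  Two neighborhoods that agree up to degree `m` differ in degree
`m + 1` by a cocycle with values in `T_C M ⊗ S^{m+1} N_C^*` (`sub_mem_Z1`), and a coboundary can be
removed from this difference by adding a term of degree `m + 1` to the conjugating map
(`conjMod_addPart`).  If the cohomology groups of all degrees above `ℓ₀` vanish then a conjugacy of
order `ℓ₀` to a foliated normal form can thus be improved to all orders, and the corrections
converge coefficient by coefficient (`exists_conj_of_subsingleton`); this gives the foliation.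

Conversely, let `Φ` have first integrals `H`.  Then `l_{kj} = 0` (`l_eq_zero`), and by induction on
`m` there is a map with horizontal components `H` that conjugates `Φ`, up to `O(m + 1)`, to a
foliated normal form `N^m(c)` (`NormalForms.exists_foliated`).  In the induction step the
difference of the two foliated neighborhoods is a cocycle with values in `N_C ⊗ S^{m+1} N_C^*`.
Since the basis cocycles are adapted to the splitting, it is a combination of basis cocycles up to
the coboundary of a vertical cochain (`CohomologyBasis.exists_vertical_decomposition`), so the
horizontal components of the map need not be changed.  An automorphism of `N^m(c)` of order `m + 1`
acts trivially on the jets of order `m + 1` that extend the jet of `N^m(c)` (`eqMod_of_aut`).  Hence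
the chosen representative of the resulting class agrees with a foliated neighborhood up to
`O(m + 2)`, and by the choice of the normal forms it is foliated.

All identities between formal power series are congruences modulo `O(|v|^{m+1})` between analytic
maps near the points of `v = 0`.  Two facts make this work: analytic maps have Taylor series in `v`
with analytic coefficients (`eqNear_taylor`, `analyticAt_taylor`), and substituting a map that is
tangent to the identity changes an analytic map of order `m` by terms of order `m + 1`
(`Series.vanishes_comp_sub`).  The second fact allows such maps to be cancelled on the right
(`Series.eqNear_of_comp`) and the equation `Ψ_{kj} ∘ F_j = F_k ∘ Φ_{kj}` to be solved for the
conjugate neighborhood `Ψ` (`exists_conj`).  The conjugate of a holomorphic neighborhood is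
holomorphic if `F` is polynomial in `v`, by the inverse function theorem (`conj_mem_holNbhds`);
to a given order every formal map may be replaced by such a map.
-/

namespace TransFol

open Filter

/-! ### Orders of vanishing along the zero section -/

section Vanishing

variable {n d : ℕ} {E E' G : Type*} [NormedAddCommGroup E] [NormedAddCommGroup E']
  [NormedAddCommGroup G]

/-- `f` vanishes to order at least `m` along `v = 0`, near the point `(p, 0)`: `f = O(|v|^m)`. -/
def Vanishes (m : ℕ) (p : Fin n → ℂ) (f : HV n d → E) : Prop :=
  f =O[𝓝 (p, (0 : Fin d → ℂ))] fun x => ‖x.2‖ ^ m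

theorem eqNear_iff {m : ℕ} {p : Fin n → ℂ} {f g : HV n d → E} :
    EqNear m p f g ↔ Vanishes (m + 1) p (f - g) := Iff.rfl

theorem eqNear_def {m : ℕ} {p : Fin n → ℂ} {f g : HV n d → E} :
    EqNear m p f g ↔ Vanishes (m + 1) p fun x => f x - g x := Iff.rfl

theorem tendsto_norm_snd (p : Fin n → ℂ) :
    Tendsto (fun x : HV n d => ‖x.2‖) (𝓝 (p, 0)) (𝓝 0) := by
  have h : ContinuousAt (fun x : HV n d => ‖x.2‖) (p, 0) := by fun_prop
  simpa [ContinuousAt] using h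

namespace Vanishes

variable {m m' : ℕ} {p p' : Fin n → ℂ} {f g : HV n d → E}

theorem mono (h : Vanishes m p f) (hm : m' ≤ m) : Vanishes m' p f := by
  refine IsBigO.trans h (IsBigO.of_bound 1 ?_)
  filter_upwards [(tendsto_norm_snd (d := d) p).eventually_lt_const zero_lt_one] with x hx
  simpa using pow_le_pow_of_le_one (norm_nonneg x.2) hx.le hm

theorem congr' (h : Vanishes m p f) (e : f =ᶠ[𝓝 (p, 0)] g) : Vanishes m p g :=
  IsBigO.congr' h e EventuallyEq.rfl

theorem add (hf : Vanishes m p f) (hg : Vanishes m p g) : Vanishes m p fun x => f x + g x :=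
  IsBigO.add hf hg

theorem sub (hf : Vanishes m p f) (hg : Vanishes m p g) : Vanishes m p fun x => f x - g x :=
  IsBigO.sub hf hg

theorem neg (hf : Vanishes m p f) : Vanishes m p fun x => -f x := IsBigO.neg_left hf

theorem zero : Vanishes m p (fun _ => 0 : HV n d → E) := isBigO_zero _ _

theorem sum {ι : Type*} {s : Finset ι} {f : ι → HV n d → E} (h : ∀ i ∈ s, Vanishes m p (f i)) :
    Vanishes m p fun x => ∑ i ∈ s, f i x := IsBigO.fun_sum h

theorem of_norm_le (hg : Vanishes m p g) (C : ℝ) {f : HV n d → E'}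
    (h : ∀ᶠ x in 𝓝 (p, (0 : Fin d → ℂ)), ‖f x‖ ≤ C * ‖g x‖) : Vanishes m p f :=
  (IsBigO.of_bound C h).trans hg

theorem smul [NormedSpace ℂ E] {c : HV n d → ℂ} (hc : Vanishes m p c) (hf : Vanishes m' p f) :
    Vanishes (m + m') p fun x => c x • f x := by
  simpa only [Vanishes, pow_add, smul_eq_mul] using IsBigO.smul hc hf

theorem of_continuousAt (hf : ContinuousAt f (p, 0)) : Vanishes 0 p f := by
  simpa [Vanishes] using hf.isBigO_one ℝ

theorem fst_comp {f : HV n d → E × E'} (h : Vanishes m p f) : Vanishes m p fun x => (f x).1 :=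
  (isBigO_of_le _ fun x => norm_fst_le (f x)).trans h

theorem snd_comp {f : HV n d → E × E'} (h : Vanishes m p f) : Vanishes m p fun x => (f x).2 :=
  (isBigO_of_le _ fun x => norm_snd_le (f x)).trans h

theorem prodMk {f : HV n d → E} {g : HV n d → E'} (hf : Vanishes m p f) (hg : Vanishes m p g) :
    Vanishes m p fun x => (f x, g x) := IsBigO.prod_left hf hg

theorem tendsto_zero (h : Vanishes m p f) (hm : m ≠ 0) : Tendsto f (𝓝 (p, 0)) (𝓝 0) := by
  refine IsBigO.trans_tendsto h ?_
  simpa [hm] using (tendsto_norm_snd (d := d) p).pow m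

/-- The bound that expresses the vanishing order holds on a neighborhood, so it gives the same
order at all nearby points. -/
theorem eventually (h : Vanishes m p f) : ∀ᶠ q in 𝓝 p, Vanishes m q f := by
  obtain ⟨C, hC⟩ := h.bound
  have h1 : Tendsto (fun q : Fin n → ℂ => (q, (0 : Fin d → ℂ))) (𝓝 p) (𝓝 (p, 0)) :=
    Continuous.tendsto (by fun_prop) p
  filter_upwards [h1.eventually (eventually_eventually_nhds.2 hC)] with q hq
  exact IsBigO.of_bound C hq

theorem apply_zero (h : Vanishes m p f) (hm : m ≠ 0) : f (p, 0) = 0 := by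
  obtain ⟨C, hC⟩ := h.bound
  simpa [hm] using hC.self_of_nhds

theorem ray (h : Vanishes m p f) (v : Fin d → ℂ) :
    (fun s : ℝ => f (p, (s : ℂ) • v)) =O[𝓝 0] fun s => s ^ m := by
  have h1 : Tendsto (fun s : ℝ => (p, (s : ℂ) • v)) (𝓝 0) (𝓝 (p, (0 : Fin d → ℂ))) := by
    have : Continuous (fun s : ℝ => (p, (s : ℂ) • v)) := by fun_prop
    simpa using this.tendsto 0
  refine (IsBigO.comp_tendsto h h1).trans (IsBigO.of_bound (‖v‖ ^ m) (.of_forall fun s => ?_))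
  simp [norm_smul, mul_pow, mul_comm]

end Vanishes

/-- `y` maps a neighborhood of `(p, 0)` to one of `(p', 0)` and respects the zero sections. -/
structure Preserves (p p' : Fin n → ℂ) (y : HV n d → HV n d) : Prop where
  tendsto : Tendsto y (𝓝 (p, 0)) (𝓝 (p', 0))
  snd : Vanishes 1 p fun x => (y x).2

theorem Preserves.id (p : Fin n → ℂ) : Preserves p p (fun x : HV n d => x) :=
  ⟨tendsto_id, by
    simpa [Vanishes] using isBigO_refl (fun x : HV n d => x.2) (𝓝 (p, 0))⟩

theorem Preserves.comp {p p' p'' : Fin n → ℂ} {y z : HV n d → HV n d} (hz : Preserves p' p'' z)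
    (hy : Preserves p p' y) : Preserves p p'' fun x => z (y x) := by
  refine ⟨hz.tendsto.comp hy.tendsto, ?_⟩
  have := IsBigO.comp_tendsto hz.snd hy.tendsto
  refine this.trans ?_
  simpa [Vanishes, Function.comp_def] using hy.snd.norm_left

theorem Vanishes.comp {m : ℕ} {p p' : Fin n → ℂ} {f : HV n d → E} {y : HV n d → HV n d}
    (hf : Vanishes m p' f) (hy : Preserves p p' y) : Vanishes m p fun x => f (y x) := by
  refine (IsBigO.comp_tendsto hf hy.tendsto).trans ?_
  have := hy.snd.norm_left.pow m
  simpa [Vanishes, Function.comp_def] using this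

theorem Preserves.congr {p p' : Fin n → ℂ} {y z : HV n d → HV n d} (hy : Preserves p p' y)
    (h : Vanishes 1 p fun x => y x - z x) : Preserves p p' z := by
  constructor
  · simpa using hy.tendsto.sub (h.tendsto_zero one_ne_zero)
  · simpa using hy.snd.sub h.snd_comp

theorem EqNear.mono {m m' : ℕ} {p : Fin n → ℂ} {f g : HV n d → E} (h : EqNear m p f g)
    (hm : m' ≤ m) : EqNear m' p f g :=
  Vanishes.mono (eqNear_iff.1 h) (by omega)

theorem EqNear.refl {m : ℕ} {p : Fin n → ℂ} (f : HV n d → E) : EqNear m p f f := by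
  simpa [eqNear_def] using Vanishes.zero

theorem EqNear.of_eventuallyEq {m : ℕ} {p : Fin n → ℂ} {f g : HV n d → E}
    (h : f =ᶠ[𝓝 (p, 0)] g) : EqNear m p f g :=
  (EqNear.refl f).congr' (h.mono fun x hx => by simp [hx]) EventuallyEq.rfl

theorem EqNear.symm {m : ℕ} {p : Fin n → ℂ} {f g : HV n d → E} (h : EqNear m p f g) :
    EqNear m p g f := by
  simpa [eqNear_def] using (eqNear_def.1 h).neg

theorem EqNear.trans {m : ℕ} {p : Fin n → ℂ} {f g k : HV n d → E} (h : EqNear m p f g)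
    (h' : EqNear m p g k) : EqNear m p f k := by
  simpa [eqNear_def] using (eqNear_def.1 h).add (eqNear_def.1 h')

theorem EqNear.comp {m : ℕ} {p p' : Fin n → ℂ} {f g : HV n d → E} {y : HV n d → HV n d}
    (h : EqNear m p' f g) (hy : Preserves p p' y) :
    EqNear m p (fun x => f (y x)) fun x => g (y x) :=
  Vanishes.comp (eqNear_def.1 h) hy

theorem EqNear.fst_comp {m : ℕ} {p : Fin n → ℂ} {f g : HV n d → E × E'} (h : EqNear m p f g) :
    EqNear m p (fun x => (f x).1) fun x => (g x).1 :=
  Vanishes.fst_comp (eqNear_def.1 h)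

variable [NormedSpace ℂ E] [NormedSpace ℂ G]

/-- Analytic maps preserve congruences modulo `O(m + 1)`. -/
theorem EqNear.analytic_comp {m : ℕ} {p : Fin n → ℂ} {x₀ : E} {f g : HV n d → E} {F : E → G}
    (h : EqNear m p f g) (hF : AnalyticAt ℂ F x₀) (hf : Tendsto f (𝓝 (p, 0)) (𝓝 x₀))
    (hg : Tendsto g (𝓝 (p, 0)) (𝓝 x₀)) : EqNear m p (fun x => F (f x)) fun x => F (g x) := by
  have h1 := hF.hasStrictFDerivAt.isBigO_sub
  exact (h1.comp_tendsto (hf.prodMk_nhds hg)).trans h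

/-- First order expansion with a quadratic remainder, uniformly in the base points. -/
theorem exists_norm_sub_sub_fderiv_le [CompleteSpace G] {x₀ : E} {f : E → G}
    (hf : AnalyticAt ℂ f x₀) :
    ∃ K : ℝ, 0 ≤ K ∧ ∀ᶠ z : E × E × E in 𝓝 (x₀, x₀, 0),
      ‖f (z.1 + z.2.2) - f z.1 - fderiv ℂ f z.2.1 z.2.2‖
        ≤ K * (‖z.1 - z.2.1‖ + ‖z.2.2‖) * ‖z.2.2‖ := by
  obtain ⟨K, s, hs, hK⟩ :=
    (hf.fderiv.contDiffAt (n := 1)).exists_lipschitzOnWith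
  have h1 : ∀ᶠ x in 𝓝 x₀, AnalyticAt ℂ f x ∧ x ∈ s := hf.eventually_analyticAt.and hs
  obtain ⟨r, hr, hball⟩ := Metric.eventually_nhds_iff_ball.1 h1
  refine ⟨K, K.2, ?_⟩
  have t1 : ∀ᶠ z : E × E × E in 𝓝 (x₀, x₀, 0), z.1 ∈ Metric.ball x₀ r :=
    (continuous_fst.tendsto (x₀, x₀, (0 : E))).eventually (Metric.ball_mem_nhds _ hr)
  have t2 : ∀ᶠ z : E × E × E in 𝓝 (x₀, x₀, 0), z.2.1 ∈ Metric.ball x₀ r :=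
    ((continuous_fst.comp continuous_snd).tendsto (x₀, x₀, (0 : E))).eventually
      (Metric.ball_mem_nhds _ hr)
  have t3 : ∀ᶠ z : E × E × E in 𝓝 (x₀, x₀, 0), z.1 + z.2.2 ∈ Metric.ball x₀ r := by
    have : Continuous fun z : E × E × E => z.1 + z.2.2 := by fun_prop
    refine (this.tendsto (x₀, x₀, (0 : E))).eventually ?_
    rw [add_zero]
    exact Metric.ball_mem_nhds x₀ hr
  filter_upwards [t1, t2, t3] with ⟨y, b, w⟩ hy hb hyw
  let : NormedSpace ℝ E := .restrictScalars ℝ ℂ E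
  have hseg : segment ℝ y (y + w) ⊆ Metric.ball x₀ r :=
    (convex_ball x₀ r).segment_subset hy hyw
  have := Convex.norm_image_sub_le_of_norm_fderiv_le' (𝕜 := ℂ) (f := f) (φ := fderiv ℂ f b)
    (C := K * (‖y - b‖ + ‖w‖)) (s := segment ℝ y (y + w))
    (fun x hx => (hball x (hseg hx)).1.differentiableAt) (fun x hx => ?_) (convex_segment _ _)
    (left_mem_segment ℝ _ _) (right_mem_segment ℝ _ _)
  · simpa using this
  · refine ((hK.norm_sub_le (hball x (hseg hx)).2 (hball b hb).2)).trans ?_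
    gcongr
    obtain ⟨t, ⟨ht0, ht1⟩, rfl⟩ := (segment_eq_image' ℝ y (y + w) ▸ hx)
    calc ‖y + t • (y + w - y) - b‖ = ‖(y - b) + t • w‖ := by congr 1; simp; abel
      _ ≤ ‖y - b‖ + ‖t • w‖ := norm_add_le _ _
      _ ≤ ‖y - b‖ + ‖w‖ := by
        rw [norm_smul, Real.norm_of_nonneg ht0]
        gcongr
        exact mul_le_of_le_one_left (norm_nonneg _) ht1

/-- If `w = O(|v|^m)`, `m ≥ 1`, and `y = b + O(|v|)` then
`f (y + w) = f (y) + Df(b) w + O(|v|^{m+1})`. -/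
theorem eqNear_add_fderiv [CompleteSpace G] {m : ℕ} (hm : 1 ≤ m) {p : Fin n → ℂ} {x₀ : E}
    {f : E → G} {y z b : HV n d → E}
    (hf : AnalyticAt ℂ f x₀) (hy : Tendsto y (𝓝 (p, 0)) (𝓝 x₀))
    (hb : Vanishes 1 p fun x => y x - b x) (hw : Vanishes m p fun x => z x - y x) :
    EqNear m p (fun x => f (z x)) fun x => f (y x) + fderiv ℂ f (b x) (z x - y x) := by
  obtain ⟨K, hK0, hK⟩ := exists_norm_sub_sub_fderiv_le hf
  have hb' : Tendsto b (𝓝 (p, 0)) (𝓝 x₀) := by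
    simpa using hy.sub (hb.tendsto_zero one_ne_zero)
  have ht := hy.prodMk_nhds (hb'.prodMk_nhds (hw.tendsto_zero (by omega)))
  have h1 : Vanishes (1 + m) p fun x => (‖y x - b x‖ + ‖z x - y x‖ : ℝ) * ‖z x - y x‖ := by
    have := IsBigO.mul (hb.norm_left.add (hw.mono hm).norm_left) hw.norm_left
    simpa [Vanishes, pow_add] using this
  rw [eqNear_def, add_comm m]
  refine (IsBigO.of_bound K ?_).trans h1
  filter_upwards [ht.eventually hK] with x hx
  simp only [add_sub_cancel] at hx
  rw [← sub_sub, Real.norm_of_nonneg (by positivity), ← mul_assoc]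
  exact hx

end Vanishing

/-! ### Taylor expansion along the zero section -/

section Taylor

variable {n d : ℕ}

/-- Taylor's formula in the vertical direction; the scale `t ∈ [0, 1]` is carried along in order
to integrate the formula for the derivative of `f` along the rays `t ↦ (h, t v)`. -/
theorem exists_norm_sub_taylor_le (m : ℕ) :
    ∀ {E : Type*} [NormedAddCommGroup E] [NormedSpace ℂ E] [CompleteSpace E]
      {p : Fin n → ℂ} {f : HV n d → E}, AnalyticAt ℂ f (p, 0) →
      ∃ K : ℝ, ∀ᶠ x : HV n d in 𝓝 (p, 0), ∀ t ∈ Set.Icc (0 : ℝ) 1,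
        ‖f (x.1, (t : ℂ) • x.2) - ∑ k ∈ Finset.range m, ((t : ℂ) ^ k / (k.factorial : ℂ)) •
          iteratedFDeriv ℂ k f (x.1, 0) (fun _ => (0, x.2))‖ ≤ K * ‖x.2‖ ^ m := by
  have key : ∀ {P : HV n d → Prop} {p : Fin n → ℂ}, (∀ᶠ x in 𝓝 (p, 0), P x) →
      ∀ᶠ x : HV n d in 𝓝 (p, 0), ∀ t ∈ Set.Icc (0 : ℝ) 1, P (x.1, (t : ℂ) • x.2) := by
    intro P p hP
    obtain ⟨r, hr, hball⟩ := Metric.eventually_nhds_iff_ball.1 hP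
    filter_upwards [Metric.ball_mem_nhds _ hr] with x hx t ht
    refine hball _ ?_
    simp only [Metric.mem_ball, Prod.dist_eq, sup_lt_iff, dist_zero_right] at hx ⊢
    refine ⟨hx.1, lt_of_le_of_lt ?_ hx.2⟩
    rw [norm_smul, Complex.norm_real, Real.norm_of_nonneg ht.1]
    exact mul_le_of_le_one_left (norm_nonneg _) ht.2
  induction m with
  | zero =>
    intro E _ _ _ p f hf
    obtain ⟨K, hK⟩ := (hf.continuousAt.isBigO_one ℝ).bound
    refine ⟨K, ?_⟩
    filter_upwards [key hK] with x hx t ht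
    simpa using hx t ht
  | succ m ih =>
    intro E _ _ _ p f hf
    obtain ⟨K, hK⟩ := ih hf.fderiv
    refine ⟨K, ?_⟩
    filter_upwards [hK, key hf.eventually_analyticAt] with x hx han t ht
    set w : HV n d := (0, x.2)
    -- the derivative of the remainder along the ray is the remainder of the derivative of `f`
    have hder : ∀ s ∈ Set.Icc (0 : ℝ) 1, HasDerivWithinAt
        (fun s : ℝ => f (x.1, (s : ℂ) • x.2) - ∑ k ∈ Finset.range (m + 1),
          ((s : ℂ) ^ k / (k.factorial : ℂ)) • iteratedFDeriv ℂ k f (x.1, 0) (fun _ => w))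
        ((fderiv ℂ f (x.1, (s : ℂ) • x.2) - ∑ k ∈ Finset.range m,
          ((s : ℂ) ^ k / (k.factorial : ℂ)) •
            iteratedFDeriv ℂ k (fderiv ℂ f) (x.1, 0) (fun _ => w)) w) (Set.Icc 0 1) s := by
      intro s hs
      refine HasDerivAt.hasDerivWithinAt ?_
      have h1 : HasDerivAt (fun z : ℂ => (x.1, z • x.2)) w (s : ℂ) := by
        simpa using (hasDerivAt_const (s : ℂ) x.1).prodMk ((hasDerivAt_id (s : ℂ)).smul_const x.2)
      have h2 := ((han s hs).differentiableAt.hasFDerivAt.comp_hasDerivAt (s : ℂ) h1)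
      have h3 : HasDerivAt (fun z : ℂ => ∑ k ∈ Finset.range (m + 1),
          (z ^ k / (k.factorial : ℂ)) • iteratedFDeriv ℂ k f (x.1, 0) (fun _ => w))
          (∑ k ∈ Finset.range m, ((s : ℂ) ^ k / (k.factorial : ℂ)) •
            iteratedFDeriv ℂ (k + 1) f (x.1, 0) (fun _ => w)) (s : ℂ) := by
        have h4 : ∀ k ∈ Finset.range (m + 1), HasDerivAt (fun z : ℂ =>
            (z ^ k / (k.factorial : ℂ)) • iteratedFDeriv ℂ k f (x.1, 0) (fun _ => w))
            (((k : ℂ) * (s : ℂ) ^ (k - 1) / (k.factorial : ℂ)) •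
              iteratedFDeriv ℂ k f (x.1, 0) (fun _ => w)) (s : ℂ) := fun k _ =>
          ((hasDerivAt_pow k (s : ℂ)).div_const _).smul_const _
        have h5 := HasDerivAt.fun_sum h4
        rw [Finset.sum_range_succ'] at h5
        convert h5 using 1
        simp only [Nat.cast_zero, zero_mul, zero_div, zero_smul, add_zero]
        refine Finset.sum_congr rfl fun k _ => ?_
        congr 1
        have : ((k : ℂ) + 1) ≠ 0 := by exact_mod_cast Nat.succ_ne_zero k
        rw [Nat.factorial_succ]
        push_cast
        field_simp
      have h6 := (h2.sub h3).scomp s (Complex.ofRealCLM.hasDerivAt (x := s))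
      convert h6 using 1
      · rfl
      rw [Complex.ofRealCLM_apply, Complex.ofReal_one, one_smul, _root_.sub_apply, _root_.sum_apply]
      congr 1
      refine Finset.sum_congr rfl fun k _ => ?_
      rw [_root_.smul_apply, iteratedFDeriv_succ_apply_right]
      rfl
    have hb := Convex.norm_image_sub_le_of_norm_hasDerivWithin_le (C := K * ‖x.2‖ ^ (m + 1)) hder
      (fun s hs => ?_) (convex_Icc 0 1) (Set.left_mem_Icc.2 zero_le_one) ht
    · have h0 : f (x.1, ((0 : ℝ) : ℂ) • x.2) - ∑ k ∈ Finset.range (m + 1),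
          (((0 : ℝ) : ℂ) ^ k / (k.factorial : ℂ)) • iteratedFDeriv ℂ k f (x.1, 0) (fun _ => w)
          = 0 := by
        rw [Finset.sum_range_succ']
        simp
      rw [h0, sub_zero] at hb
      refine hb.trans ?_
      have hn : 0 ≤ K * ‖x.2‖ ^ (m + 1) := by
        have := (norm_nonneg _).trans (hx 0 (Set.left_mem_Icc.2 zero_le_one))
        rw [pow_succ, ← mul_assoc]
        positivity
      refine mul_le_of_le_one_right hn ?_
      rw [sub_zero, Real.norm_of_nonneg ht.1]
      exact ht.2
    · refine (ContinuousLinearMap.le_opNorm _ _).trans ?_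
      rw [pow_succ, ← mul_assoc]
      have hw : ‖w‖ = ‖x.2‖ := by simp [w, Prod.norm_def]
      rw [hw]
      exact mul_le_mul_of_nonneg_right (hx s hs) (norm_nonneg _)

/-- The multi-index of a list of coordinate directions. -/
def multiIndex {k : ℕ} (s : Fin k → Fin d) (i : Fin d) : ℕ :=
  (Finset.univ.filter fun j => s j = i).card

theorem sum_multiIndex {k : ℕ} (s : Fin k → Fin d) : ∑ i, multiIndex s i = k := by
  have := Finset.card_eq_sum_card_fiberwise (f := s) (s := Finset.univ) (t := Finset.univ)
    (fun _ _ => Finset.mem_univ _)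
  simpa [multiIndex] using this.symm

theorem prod_multiIndex {k : ℕ} (s : Fin k → Fin d) (v : Fin d → ℂ) :
    ∏ i, v i ^ multiIndex s i = ∏ j, v (s j) := by
  have := Finset.prod_fiberwise_of_maps_to (s := Finset.univ) (t := Finset.univ) (g := s)
    (fun _ _ => Finset.mem_univ _) (fun j => v (s j))
  rw [← this]
  refine Finset.prod_congr rfl fun i _ => ?_
  rw [Finset.prod_congr rfl (g := fun _ => v i) (fun j hj => by rw [(Finset.mem_filter.1 hj).2]),
    Finset.prod_const, multiIndex]

/-- The Taylor coefficients of `f` in the vertical direction, at the points of the zero section.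
They are read off from the iterated derivatives, by summing over all lists of coordinate directions
with a given multi-index. -/
noncomputable def taylor {E : Type*} [NormedAddCommGroup E] [NormedSpace ℂ E]
    (f : HV n d → E) : Series n d E := fun Q h =>
  ∑ s : Fin (∑ i, Q i) → Fin d, if multiIndex s = Q then
    (((∑ i, Q i).factorial : ℂ)⁻¹) • iteratedFDeriv ℂ (∑ i, Q i) f (h, 0)
      (fun j => (0, Pi.single (s j) 1)) else 0

variable {E : Type*} [NormedAddCommGroup E] [NormedSpace ℂ E]

theorem taylor_part (f : HV n d → E) (k : ℕ) (h : Fin n → ℂ) (v : Fin d → ℂ) :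
    (taylor f).part k h v
      = ((k.factorial : ℂ)⁻¹) • iteratedFDeriv ℂ k f (h, 0) (fun _ => (0, v)) := by
  have hv : ((0, v) : HV n d) = ∑ i, v i • ((0, Pi.single i 1) : HV n d) := by
    ext i
    · simp [Prod.fst_sum]
    · simp [Prod.snd_sum, Pi.single_apply]
  have hexp : iteratedFDeriv ℂ k f (h, 0) (fun _ => (0, v)) = ∑ s : Fin k → Fin d,
      (∏ j, v (s j)) • iteratedFDeriv ℂ k f (h, 0) (fun j => (0, Pi.single (s j) 1)) := by
    rw [hv, ContinuousMultilinearMap.map_sum]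
    exact Finset.sum_congr rfl fun s _ => ContinuousMultilinearMap.map_smul_univ _ _ _
  have hQ : ∀ Q ∈ Finset.piAntidiag (Finset.univ : Finset (Fin d)) k,
      (∏ i, v i ^ Q i) • taylor f Q h = ∑ s : Fin k → Fin d, if multiIndex s = Q then
        ((k.factorial : ℂ)⁻¹) • (∏ j, v (s j)) •
          iteratedFDeriv ℂ k f (h, 0) (fun j => (0, Pi.single (s j) 1)) else 0 := by
    intro Q hQ
    obtain rfl : ∑ i, Q i = k := (Finset.mem_piAntidiag.1 hQ).1
    rw [taylor, Finset.smul_sum]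
    refine Finset.sum_congr rfl fun s _ => ?_
    split_ifs with hs
    · rw [smul_comm, ← prod_multiIndex, hs]
    · rw [smul_zero]
  rw [Series.part, Finset.sum_congr rfl hQ, Finset.sum_comm, hexp, Finset.smul_sum]
  refine Finset.sum_congr rfl fun s _ => ?_
  rw [Finset.sum_ite_eq, if_pos]
  simp [Finset.mem_piAntidiag, sum_multiIndex]

variable [CompleteSpace E]

/-- Analytic maps have Taylor expansions in `v`, uniformly near the points of the zero section. -/
theorem eqNear_taylor {p : Fin n → ℂ} {f : HV n d → E} (hf : AnalyticAt ℂ f (p, 0)) (m : ℕ) :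
    EqNear m p f ((taylor f).trunc m) := by
  obtain ⟨K, hK⟩ := exists_norm_sub_taylor_le (m + 1) hf
  refine IsBigO.of_bound K ?_
  filter_upwards [hK] with x hx
  simpa [Series.trunc, taylor_part] using hx 1 (Set.right_mem_Icc.2 zero_le_one)

theorem analyticAt_taylor {p : Fin n → ℂ} {f : HV n d → E} (hf : AnalyticAt ℂ f (p, 0))
    (Q : Fin d → ℕ) : AnalyticAt ℂ (taylor f Q) p := by
  refine Finset.analyticAt_fun_sum _ fun s _ => ?_
  split_ifs
  · have h1 : AnalyticAt ℂ (iteratedFDeriv ℂ (∑ i, Q i) f) (p, 0) := by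
      obtain ⟨u, hu, hu'⟩ := hf.exists_mem_nhds_analyticOnNhd
      exact hu'.iteratedFDeriv _ _ (mem_of_mem_nhds hu)
    have h2 : AnalyticAt ℂ (fun h : Fin n → ℂ => ((h, 0) : HV n d)) p :=
      analyticAt_id.prod analyticAt_const
    have h3 : AnalyticAt ℂ (fun h => iteratedFDeriv ℂ (∑ i, Q i) f (h, 0)) p :=
      AnalyticAt.fun_comp (g := iteratedFDeriv ℂ (∑ i, Q i) f) h1 h2
    have h4 := ((ContinuousMultilinearMap.apply ℂ (fun _ : Fin (∑ i, Q i) => HV n d) E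
      (fun j => (0, Pi.single (s j) 1))).analyticAt _).fun_comp h3
    exact analyticAt_const.smul h4
  · exact analyticAt_const

end Taylor

/-! ### Truncated power series as maps -/

section SeriesMaps

variable {n d : ℕ} {E : Type*} [NormedAddCommGroup E] [NormedSpace ℂ E]

namespace Series

theorem part_add (a b : Series n d E) (m : ℕ) (h : Fin n → ℂ) (v : Fin d → ℂ) :
    Series.part (a + b) m h v = a.part m h v + b.part m h v := by
  simp [Series.part, smul_add, Finset.sum_add_distrib]

theorem part_sub (a b : Series n d E) (m : ℕ) (h : Fin n → ℂ) (v : Fin d → ℂ) :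
    Series.part (a - b) m h v = a.part m h v - b.part m h v := by
  simp [Series.part, smul_sub, Finset.sum_sub_distrib]

theorem part_arg_smul (a : Series n d E) (m : ℕ) (h : Fin n → ℂ) (c : ℂ) (v : Fin d → ℂ) :
    a.part m h (c • v) = c ^ m • a.part m h v := by
  rw [Series.part, Series.part, Finset.smul_sum]
  refine Finset.sum_congr rfl fun Q hQ => ?_
  rw [smul_smul]
  congr 1
  simp only [Pi.smul_apply, smul_eq_mul, mul_pow, Finset.prod_mul_distrib,
    Finset.prod_pow_eq_pow_sum, (Finset.mem_piAntidiag.1 hQ).1]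

theorem part_congr {a b : Series n d E} {m : ℕ} {h : Fin n → ℂ}
    (hab : ∀ Q, ∑ i, Q i = m → a Q h = b Q h) (v : Fin d → ℂ) :
    a.part m h v = b.part m h v :=
  Finset.sum_congr rfl fun Q hQ => by rw [hab Q (Finset.mem_piAntidiag.1 hQ).1]

theorem trunc_congr {a b : Series n d E} {m : ℕ} {x : HV n d}
    (hab : ∀ Q, ∑ i, Q i ≤ m → a Q x.1 = b Q x.1) : a.trunc m x = b.trunc m x :=
  Finset.sum_congr rfl fun q hq =>
    part_congr (fun Q hQ => hab Q (by have := Finset.mem_range.1 hq; omega)) _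

theorem part_zero_eq (a : Series n d E) (h : Fin n → ℂ) (v : Fin d → ℂ) :
    a.part 0 h v = a 0 h := by
  simp [Series.part]

theorem trunc_zero_eq (a : Series n d E) (x : HV n d) : a.trunc 0 x = a 0 x.1 := by
  simp [Series.trunc, part_zero_eq]

theorem trunc_succ (a : Series n d E) (m : ℕ) (x : HV n d) :
    a.trunc (m + 1) x = a.trunc m x + a.part (m + 1) x.1 x.2 :=
  Finset.sum_range_succ _ _

theorem fst_part {E' : Type*} [NormedAddCommGroup E'] [NormedSpace ℂ E']
    (a : Series n d (E × E')) (m : ℕ) (h : Fin n → ℂ) (v : Fin d → ℂ) :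
    (a.part m h v).1 = Series.part (fun Q h => (a Q h).1) m h v := by
  simp [Series.part, Prod.fst_sum]

theorem snd_part {E' : Type*} [NormedAddCommGroup E'] [NormedSpace ℂ E']
    (a : Series n d (E × E')) (m : ℕ) (h : Fin n → ℂ) (v : Fin d → ℂ) :
    (a.part m h v).2 = Series.part (fun Q h => (a Q h).2) m h v := by
  simp [Series.part, Prod.snd_sum]

theorem fst_trunc {E' : Type*} [NormedAddCommGroup E'] [NormedSpace ℂ E']
    (a : Series n d (E × E')) (m : ℕ) (x : HV n d) :
    (a.trunc m x).1 = Series.trunc (fun Q h => (a Q h).1) m x := by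
  simp [Series.trunc, fst_part, Prod.fst_sum]

theorem analyticAt_part {a : Series n d E} {m : ℕ} {x : HV n d}
    (ha : ∀ Q, ∑ i, Q i = m → AnalyticAt ℂ (a Q) x.1) :
    AnalyticAt ℂ (fun x : HV n d => a.part m x.1 x.2) x := by
  refine Finset.analyticAt_fun_sum _ fun Q hQ => ?_
  have h1 : AnalyticAt ℂ (fun x : HV n d => a Q x.1) x :=
    (ha Q (Finset.mem_piAntidiag.1 hQ).1).fun_comp analyticAt_fst
  have h2 : AnalyticAt ℂ (fun x : HV n d => ∏ i, x.2 i ^ Q i) x := by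
    refine Finset.analyticAt_fun_prod _ fun i _ => AnalyticAt.fun_pow ?_ _
    exact ((ContinuousLinearMap.proj (R := ℂ) (φ := fun _ : Fin d => ℂ) i).analyticAt _).fun_comp
      analyticAt_snd
  exact h2.smul h1

theorem analyticAt_trunc {a : Series n d E} {m : ℕ} {x : HV n d}
    (ha : ∀ Q, AnalyticAt ℂ (a Q) x.1) : AnalyticAt ℂ (a.trunc m) x :=
  Finset.analyticAt_fun_sum _ fun _ _ => analyticAt_part fun Q _ => ha Q

theorem vanishes_part {a : Series n d E} {m : ℕ} {p : Fin n → ℂ}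
    (ha : ∀ Q, ∑ i, Q i = m → AnalyticAt ℂ (a Q) p) :
    Vanishes m p fun x => a.part m x.1 x.2 := by
  refine Vanishes.sum fun Q hQ => ?_
  have hQ' := (Finset.mem_piAntidiag.1 hQ).1
  have h1 : Vanishes 0 p fun x : HV n d => a Q x.1 :=
    .of_continuousAt (((ha Q hQ').continuousAt).comp (x := ((p, 0) : HV n d))
      (f := Prod.fst) continuousAt_fst)
  have h2 : Vanishes m p fun x : HV n d => ∏ i, x.2 i ^ Q i := by
    refine IsBigO.of_bound 1 (.of_forall fun x => ?_)
    rw [norm_prod, one_mul, norm_pow, norm_norm, ← hQ', ← Finset.prod_pow_eq_pow_sum]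
    refine Finset.prod_le_prod (fun i _ => norm_nonneg _) fun i _ => ?_
    rw [norm_pow]
    exact pow_le_pow_left₀ (norm_nonneg _) (norm_le_pi_norm x.2 i) _
  exact h2.smul h1

theorem eqNear_trunc_of_le {a : Series n d E} {m m' : ℕ} {p : Fin n → ℂ}
    (ha : ∀ Q, AnalyticAt ℂ (a Q) p) (hm : m ≤ m') : EqNear m p (a.trunc m') (a.trunc m) := by
  induction m', hm using Nat.le_induction with
  | base => exact EqNear.refl _
  | succ k hk ih =>
    refine EqNear.trans ?_ ih
    rw [eqNear_def]
    simp only [trunc_succ, add_sub_cancel_left]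
    exact (vanishes_part fun Q _ => ha Q).mono (by omega)

/-- A map that is homogeneous of degree `m` in `v` is determined by its values up to
`O(m + 1)`. -/
theorem eq_zero_of_homogeneous {P : HV n d → E} {m : ℕ} {p : Fin n → ℂ}
    (hP : ∀ (c : ℂ) v, P (p, c • v) = c ^ m • P (p, v)) (h : Vanishes (m + 1) p P)
    (v : Fin d → ℂ) : P (p, v) = 0 := by
  have h1 := h.ray v
  simp only [hP] at h1
  obtain ⟨K, hK⟩ := h1.bound
  have h2 : ∀ᶠ s : ℝ in 𝓝[>] 0, ‖P (p, v)‖ ≤ K * s := by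
    filter_upwards [hK.filter_mono nhdsWithin_le_nhds, self_mem_nhdsWithin] with s hs hs0
    have hs0 : 0 < s := hs0
    rw [norm_smul, norm_pow, norm_pow, Complex.norm_real, Real.norm_of_nonneg hs0.le,
      pow_succ] at hs
    refine le_of_mul_le_mul_left (a := s ^ m) ?_ (by positivity)
    linarith
  have h3 : Tendsto (fun s : ℝ => K * s) (𝓝[>] 0) (𝓝 0) := by
    have : Continuous fun s : ℝ => K * s := by fun_prop
    simpa using (this.tendsto 0).mono_left nhdsWithin_le_nhds
  simpa using ge_of_tendsto h3 h2

theorem part_eq_of_eqNear {a b : Series n d E} {m : ℕ} {p : Fin n → ℂ}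
    (h : EqNear m p (fun x => a.part m x.1 x.2) fun x => b.part m x.1 x.2) (v : Fin d → ℂ) :
    a.part m p v = b.part m p v :=
  sub_eq_zero.1 <| eq_zero_of_homogeneous
    (P := fun x : HV n d => a.part m x.1 x.2 - b.part m x.1 x.2)
    (fun c v => by simp only [part_arg_smul, smul_sub]) (eqNear_def.1 h) v

/-- The coefficients of a homogeneous polynomial are determined by its values. -/
theorem coeff_eq_zero_of_part {a : Series n d E} {m : ℕ} {p : Fin n → ℂ}
    (h : ∀ v, a.part m p v = 0) {Q : Fin d → ℕ} (hQ : ∑ i, Q i = m) : a Q p = 0 := by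
  refine SeparatingDual.eq_zero_of_forall_dual_eq_zero (R := ℂ) fun g => ?_
  set P : MvPolynomial (Fin d) ℂ := ∑ Q ∈ Finset.piAntidiag (Finset.univ : Finset (Fin d)) m,
    MvPolynomial.monomial (Finsupp.equivFunOnFinite.symm Q) (g (a Q p)) with hP
  have hP0 : P = 0 := by
    refine MvPolynomial.funext fun v => ?_
    have := congrArg g (h v)
    simp only [Series.part, map_sum, map_smul, smul_eq_mul, map_zero] at this
    simp only [hP, map_sum, map_zero, MvPolynomial.eval_monomial]
    rw [← this]
    refine Finset.sum_congr rfl fun Q _ => ?_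
    rw [Finsupp.prod_fintype _ _ (fun _ => pow_zero _), mul_comm]
    rfl
  have hc := congrArg (MvPolynomial.coeff (Finsupp.equivFunOnFinite.symm Q)) hP0
  simp only [hP, MvPolynomial.coeff_sum, MvPolynomial.coeff_monomial, MvPolynomial.coeff_zero,
    EmbeddingLike.apply_eq_iff_eq] at hc
  rw [Finset.sum_ite_eq', if_pos (by simp [Finset.mem_piAntidiag, hQ])] at hc
  exact hc

theorem coeff_eq_of_part {a b : Series n d E} {m : ℕ} {p : Fin n → ℂ}
    (h : ∀ v, a.part m p v = b.part m p v) {Q : Fin d → ℕ} (hQ : ∑ i, Q i = m) :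
    a Q p = b Q p := by
  have := coeff_eq_zero_of_part (a := a - b) (p := p) (m := m)
    (fun v => by rw [part_sub, h, sub_self]) hQ
  simpa [sub_eq_zero] using this

/-- A truncated power series is determined, coefficient by coefficient, modulo `O(m + 1)`. -/
theorem coeff_eq_of_eqNear {a b : Series n d E} {m : ℕ} {p : Fin n → ℂ}
    (ha : ∀ Q, AnalyticAt ℂ (a Q) p) (hb : ∀ Q, AnalyticAt ℂ (b Q) p)
    (h : EqNear m p (a.trunc m) (b.trunc m)) {Q : Fin d → ℕ} (hQ : ∑ i, Q i ≤ m) :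
    a Q p = b Q p := by
  -- induct on the degree; at each point near `p` the parts of lower degree agree
  have key : ∀ k ≤ m, ∀ᶠ q in 𝓝 p, ∀ Q : Fin d → ℕ, ∑ i, Q i = k → a Q q = b Q q := by
    intro k
    induction k using Nat.strong_induction_on with
    | _ k ih =>
      intro hk
      have hlow : ∀ᶠ q in 𝓝 p, ∀ j ∈ Finset.range k, ∀ Q : Fin d → ℕ, ∑ i, Q i = j →
          a Q q = b Q q :=
        (Filter.eventually_all_finset _).2 fun j hj =>
          ih j (Finset.mem_range.1 hj) ((Finset.mem_range.1 hj).le.trans hk)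
      have hk' : EqNear k p (a.trunc k) (b.trunc k) :=
        ((eqNear_trunc_of_le ha hk).symm.trans (h.mono hk)).trans (eqNear_trunc_of_le hb hk)
      have hpart : EqNear k p (fun x => a.part k x.1 x.2) fun x => b.part k x.1 x.2 := by
        refine (eqNear_def.1 hk').congr' ?_
        have hfst : Tendsto (fun x : HV n d => x.1) (𝓝 (p, 0)) (𝓝 p) :=
          continuous_fst.tendsto (p, (0 : Fin d → ℂ))
        filter_upwards [hfst.eventually hlow] with x hx
        rw [Series.trunc, Series.trunc, Finset.sum_range_succ, Finset.sum_range_succ,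
          Finset.sum_congr rfl (g := fun q => Series.part b q x.1 x.2)
            fun j hj => part_congr (hx j hj) x.2]
        abel
      filter_upwards [(eqNear_def.1 hpart).eventually] with q hq Q hQ
      exact coeff_eq_of_part (fun v => part_eq_of_eqNear (eqNear_def.2 hq) v) hQ
  exact (key _ hQ).self_of_nhds Q rfl

/-- Substitution into a homogeneous polynomial only depends, modulo terms of higher order, on the
leading terms of the two components of the inner map. -/
theorem eqNear_part_comp {a : Series n d E} {m : ℕ} {p p' : Fin n → ℂ}
    (ha : ∀ Q, ∑ i, Q i = m → AnalyticAt ℂ (a Q) p') {y b : HV n d → HV n d}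
    (hy : Preserves p p' y) (h1 : Vanishes 1 p fun x => (y x).1 - (b x).1)
    (h2 : Vanishes 2 p fun x => (y x).2 - (b x).2) :
    EqNear m p (fun x => a.part m (y x).1 (y x).2) fun x => a.part m (b x).1 (b x).2 := by
  have hb : Preserves p p' b := hy.congr (h1.prodMk (h2.mono one_le_two))
  have hmon : ∀ (s : Finset (Fin d)) (Q : Fin d → ℕ),
      (Vanishes (∑ i ∈ s, Q i) p fun x => ∏ i ∈ s, (y x).2 i ^ Q i) ∧
      (Vanishes (∑ i ∈ s, Q i) p fun x => ∏ i ∈ s, (b x).2 i ^ Q i) ∧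
      Vanishes (∑ i ∈ s, Q i + 1) p
        fun x => ∏ i ∈ s, (y x).2 i ^ Q i - ∏ i ∈ s, (b x).2 i ^ Q i := by
    have hmul : ∀ {k l : ℕ} {f f' g g' : HV n d → ℂ}, (Vanishes k p f ∧ Vanishes k p f' ∧
        Vanishes (k + 1) p fun x => f x - f' x) → (Vanishes l p g ∧ Vanishes l p g' ∧
        Vanishes (l + 1) p fun x => g x - g' x) →
        (Vanishes (k + l) p fun x => f x * g x) ∧ (Vanishes (k + l) p fun x => f' x * g' x) ∧
        Vanishes (k + l + 1) p fun x => f x * g x - f' x * g' x := by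
      rintro k l f f' g g' ⟨hf, hf', hff⟩ ⟨hg, hg', hgg⟩
      refine ⟨hf.smul hg, hf'.smul hg', ?_⟩
      have e1 := (hff.smul hg).mono (m' := k + l + 1) (by omega)
      have e2 := (hf'.smul hgg).mono (m' := k + l + 1) (by omega)
      refine (e1.add e2).congr' (.of_forall fun x => ?_)
      simp only [smul_eq_mul]
      ring
    have hone : (Vanishes 0 p fun _ : HV n d => (1 : ℂ)) := .of_continuousAt continuousAt_const
    have hone' : (Vanishes 0 p fun _ : HV n d => (1 : ℂ)) ∧
        (Vanishes 0 p fun _ : HV n d => (1 : ℂ)) ∧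
        Vanishes (0 + 1) p fun _ : HV n d => (1 : ℂ) - 1 :=
      ⟨hone, hone, by simpa using Vanishes.zero⟩
    have hcoord : ∀ {k : ℕ} {f : HV n d → Fin d → ℂ} (i : Fin d), Vanishes k p f →
        Vanishes k p fun x => f x i := fun i hf =>
      hf.of_norm_le 1 (.of_forall fun x => by simpa using norm_le_pi_norm _ i)
    have hpow : ∀ (i : Fin d) (k : ℕ), (Vanishes k p fun x => (y x).2 i ^ k) ∧
        (Vanishes k p fun x => (b x).2 i ^ k) ∧
        Vanishes (k + 1) p fun x => (y x).2 i ^ k - (b x).2 i ^ k := by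
      intro i k
      induction k with
      | zero => simpa using hone'
      | succ k ih =>
        simp only [pow_succ]
        exact hmul ih ⟨hcoord i hy.snd, hcoord i hb.snd, hcoord i h2⟩
    intro s Q
    induction s using Finset.induction_on with
    | empty => simpa using hone'
    | insert i s hi ih =>
      simp only [Finset.prod_insert hi, Finset.sum_insert hi]
      exact hmul (hpow i (Q i)) ih
  rw [eqNear_def]
  simp only [Series.part, ← Finset.sum_sub_distrib]
  refine Vanishes.sum fun Q hQ => ?_
  have hQ' := (Finset.mem_piAntidiag.1 hQ).1
  obtain ⟨hy1, hb1, hyb⟩ := hmon Finset.univ Q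
  rw [hQ'] at hy1 hb1 hyb
  have hfy : Tendsto (fun x => (y x).1) (𝓝 (p, 0)) (𝓝 p') :=
    (continuous_fst.tendsto _).comp hy.tendsto
  have hfb : Tendsto (fun x => (b x).1) (𝓝 (p, 0)) (𝓝 p') :=
    (continuous_fst.tendsto _).comp hb.tendsto
  have ey : Vanishes 0 p fun x => a Q (y x).1 := by
    simpa [Vanishes, Function.comp_def] using
      ((ha Q hQ').continuousAt.tendsto.comp hfy).isBigO_one ℝ
  have eab : Vanishes 1 p fun x => a Q (y x).1 - a Q (b x).1 :=
    eqNear_def.1 ((eqNear_def (m := 0)).2 h1 |>.analytic_comp (ha Q hQ') hfy hfb)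
  refine ((hyb.smul ey).add (hb1.smul eab)).congr' (.of_forall fun x => ?_)
  simp only [sub_smul, smul_sub]
  abel

/-- The series of an analytic map that vanishes to order `m` starts in degree `m`. -/
theorem exists_part_of_vanishes [CompleteSpace E] {R : HV n d → E} {p : Fin n → ℂ} {m : ℕ}
    (hR : AnalyticAt ℂ R (p, 0)) (h : Vanishes m p R) :
    ∃ a : Series n d E, (∀ Q, AnalyticAt ℂ (a Q) p) ∧
      EqNear m p R fun x => a.part m x.1 x.2 := by
  refine ⟨taylor R, analyticAt_taylor hR, ?_⟩
  have e := eqNear_taylor hR m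
  cases m with
  | zero =>
    refine e.trans (EqNear.of_eventuallyEq (.of_forall fun x => ?_))
    simp only [trunc_zero_eq, part_zero_eq]
  | succ m =>
    refine e.trans ?_
    have h0 : ∀ᶠ x : HV n d in 𝓝 (p, 0), (taylor R).trunc m x = 0 := by
      have h1 : ∀ᶠ q in 𝓝 p, AnalyticAt ℂ R (q, 0) := by
        have : Tendsto (fun q : Fin n → ℂ => ((q, 0) : HV n d)) (𝓝 p) (𝓝 (p, 0)) :=
          Continuous.tendsto (by fun_prop) p
        exact this.eventually hR.eventually_analyticAt
      have hfst : Tendsto (fun x : HV n d => x.1) (𝓝 (p, 0)) (𝓝 p) :=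
        continuous_fst.tendsto (p, (0 : Fin d → ℂ))
      filter_upwards [hfst.eventually h1, hfst.eventually h.eventually] with x hx1 hx2
      have hz : (0 : Series n d E).trunc m x = 0 := by simp [Series.trunc, Series.part]
      rw [← hz]
      refine trunc_congr fun Q hQ => coeff_eq_of_eqNear (m := m) (analyticAt_taylor hx1)
        (fun _ => analyticAt_const) ((eqNear_taylor hx1 m).symm.trans ?_) hQ
      rw [eqNear_def]
      simpa [Series.trunc, Series.part] using hx2
    refine EqNear.of_eventuallyEq ?_
    filter_upwards [h0] with x hx
    rw [trunc_succ, hx, zero_add]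

/-- Substitution of a map that is tangent to the identity along the zero section raises the order
of `R ∘ F - R` by one. -/
theorem vanishes_comp_sub [CompleteSpace E] {R : HV n d → E} {F : HV n d → HV n d}
    {p : Fin n → ℂ} {m : ℕ} (hR : AnalyticAt ℂ R (p, 0)) (h : Vanishes m p R)
    (hF : EqNear 1 p F fun x => x) : EqNear m p (fun x => R (F x)) R := by
  obtain ⟨a, ha, hRa⟩ := exists_part_of_vanishes hR h
  have hF' : Preserves p p F := (Preserves.id p).congr (hF.symm.mono zero_le_one)
  exact ((hRa.comp hF').trans (eqNear_part_comp (fun Q _ => ha Q) hF'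
    (hF.mono (m' := 0) zero_le_one).fst_comp (Vanishes.snd_comp hF))).trans hRa.symm

/-- Maps that are tangent to the identity along the zero section can be cancelled on the right. -/
theorem eqNear_of_comp [CompleteSpace E] {f g : HV n d → E} {F : HV n d → HV n d}
    {p : Fin n → ℂ} {m : ℕ} (hf : AnalyticAt ℂ f (p, 0)) (hg : AnalyticAt ℂ g (p, 0))
    (hF : EqNear 1 p F fun x => x) (h : EqNear m p (fun x => f (F x)) fun x => g (F x)) :
    EqNear m p f g := by
  have hR : AnalyticAt ℂ (fun x => f x - g x) (p, 0) := hf.sub hg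
  have key : ∀ k ≤ m + 1, Vanishes k p fun x => f x - g x := by
    intro k
    induction k with
    | zero => exact fun _ => .of_continuousAt hR.continuousAt
    | succ k ih =>
      intro hk
      have h1 := eqNear_def.1 (vanishes_comp_sub hR (ih (by omega)) hF)
      refine ((Vanishes.mono (eqNear_def.1 h) hk).sub h1).congr' (.of_forall fun x => ?_)
      simp
  exact key _ le_rfl

/-- Truncating both factors of a composition at different degrees. -/
theorem eqNear_trunc_comp {a : Series n d E} {b : Series n d (HV n d)} {p p' : Fin n → ℂ}
    (ha : ∀ Q, AnalyticAt ℂ (a Q) p') (hb : ∀ Q, AnalyticAt ℂ (b Q) p)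
    (hp : ∀ m, Preserves p p' (b.trunc m)) {m m' : ℕ} (hm : m' ≤ m) :
    EqNear m' p (fun x => a.trunc m (b.trunc m x)) fun x => a.trunc m' (b.trunc m' x) :=
  ((eqNear_trunc_of_le ha hm).comp (hp m)).trans
    ((eqNear_trunc_of_le hb hm).analytic_comp (analyticAt_trunc (x := (p', 0)) ha)
      (hp m).tendsto (hp m').tendsto)

/-- A map that is tangent to the identity along the zero section has derivative `1` there. -/
theorem hasFDerivAt_of_eqNear_one {F : HV n d → HV n d} {p : Fin n → ℂ}
    (hF : EqNear 1 p F fun x => x) :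
    HasFDerivAt F (ContinuousLinearMap.id ℂ (HV n d)) (p, 0) := by
  have h2 : HasFDerivAt (fun x => F x - x) (0 : HV n d →L[ℂ] HV n d) (p, 0) := by
    refine IsBigO.hasFDerivAt (n := 2) ((eqNear_def.1 hF).trans (.of_bound 1 ?_)) one_lt_two
    refine .of_forall fun x => ?_
    simp only [norm_pow, norm_norm, one_mul]
    gcongr
    simpa using norm_snd_le (x - ((p, 0) : HV n d))
  have h3 := h2.fun_add (hasFDerivAt_id (𝕜 := ℂ) ((p, 0) : HV n d))
  simpa using h3

end Series

end SeriesMaps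

/-! ### Transition functions of the covering -/

namespace Cover

variable {n : ℕ} {C : Type*} [TopologicalSpace C] [ChartedSpace (Fin n → ℂ) C] {ι : Type*}
  (U : Cover n C ι)

theorem isOpen_dom (k j : ι) : IsOpen (U.dom k j) := OpenPartialHomeomorph.open_source _

theorem isOpen_img (j : ι) : IsOpen (U.img j) := (U.chart j).open_target

variable {U}

theorem mem_dom_iff {k j : ι} {h : Fin n → ℂ} :
    h ∈ U.dom k j ↔ h ∈ U.img j ∧ (U.chart j).symm h ∈ (U.chart k).source := by
  simp [dom, img]

theorem mem_img_of_mem_dom {k j : ι} {h : Fin n → ℂ} (hh : h ∈ U.dom k j) : h ∈ U.img j :=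
  (mem_dom_iff.1 hh).1

theorem φ_mem_img {k j : ι} {h : Fin n → ℂ} (hh : h ∈ U.dom k j) : U.φ k j h ∈ U.img k :=
  (U.chart k).map_source (mem_dom_iff.1 hh).2

theorem symm_φ {k j : ι} {h : Fin n → ℂ} (hh : h ∈ U.dom k j) :
    (U.chart k).symm (U.φ k j h) = (U.chart j).symm h :=
  (U.chart k).left_inv (mem_dom_iff.1 hh).2

theorem φ_mem_dom {k j i : ι} {h : Fin n → ℂ} (hh : h ∈ U.dom₃ k j i) :
    U.φ j i h ∈ U.dom k j := by
  refine mem_dom_iff.2 ⟨φ_mem_img hh.2, ?_⟩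
  rw [symm_φ hh.2]
  exact (mem_dom_iff.1 hh.1).2

theorem φ_φ {k j i : ι} {h : Fin n → ℂ} (hh : h ∈ U.dom j i) :
    U.φ k j (U.φ j i h) = U.φ k i h :=
  congrArg (U.chart k) (symm_φ hh)

theorem analyticAt_φ [IsManifold 𝓘(ℂ, Fin n → ℂ) ω C] {k j : ι} {h : Fin n → ℂ}
    (hh : h ∈ U.dom k j) : AnalyticAt ℂ (U.φ k j) h := by
  have h1 := StructureGroupoid.compatible_of_mem_maximalAtlas (U.chart_mem j) (U.chart_mem k)
  have h2 := (contMDiffOn_of_mem_contDiffGroupoid h1).contDiffOn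
  exact ((h2.contDiffAt ((U.isOpen_dom k j).mem_nhds hh))).analyticAt

end Cover

theorem tendsto_fst (p : Fin n → ℂ) : Tendsto (fun x : HV n d => x.1) (𝓝 (p, 0)) (𝓝 p) :=
  continuous_fst.tendsto (p, (0 : Fin d → ℂ))

theorem eventually_fst_mem {n d : ℕ} {s : Set (Fin n → ℂ)} (hs : IsOpen s) {p : Fin n → ℂ}
    (hp : p ∈ s) : ∀ᶠ x : HV n d in 𝓝 (p, 0), x.1 ∈ s :=
  (tendsto_fst p).eventually (hs.mem_nhds hp)

namespace TangentBundleData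

variable {n d : ℕ} {C : Type*} [TopologicalSpace C] [ChartedSpace (Fin n → ℂ) C] {ι : Type*}
  {U : Cover n C ι} {T : TangentBundleData U d}

/-! ### Leading terms of neighborhoods and formal maps -/

theorem trunc_zero_of_mem {Φ : ι → ι → Series n d (HV n d)} (hΦ : Φ ∈ T.formalNbhds) {k j : ι}
    {x : HV n d} (hx : x.1 ∈ U.dom k j) : (Φ k j).trunc 0 x = (U.φ k j x.1, 0) := by
  rw [Series.trunc_zero_eq, (hΦ.2.1 k j x.1 hx).1]

theorem trunc_one_of_mem {Φ : ι → ι → Series n d (HV n d)} (hΦ : Φ ∈ T.formalNbhds) {k j : ι}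
    {x : HV n d} (hx : x.1 ∈ U.dom k j) : (Φ k j).trunc 1 x
      = (U.φ k j x.1 + (T.l k j x.1).mulVec x.2, (T.t k j x.1).mulVec x.2) := by
  rw [Series.trunc_succ, trunc_zero_of_mem hΦ hx, zero_add, (hΦ.2.1 k j x.1 hx).2]
  simp

theorem analyticAt_nbhd {Φ : ι → ι → Series n d (HV n d)} (hΦ : Φ ∈ T.formalNbhds) {k j : ι}
    (m : ℕ) {x : HV n d} (hx : x.1 ∈ U.dom k j) : AnalyticAt ℂ ((Φ k j).trunc m) x :=
  Series.analyticAt_trunc fun Q => hΦ.1 k j Q _ hx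

theorem analyticAt_map {F : ι → Series n d (HV n d)} (hF : F ∈ T.formalMaps) {j : ι}
    (m : ℕ) {x : HV n d} (hx : x.1 ∈ U.img j) : AnalyticAt ℂ ((F j).trunc m) x :=
  Series.analyticAt_trunc fun Q => hF.1 j Q _ hx

theorem nbhd_eqNear_zero {Φ : ι → ι → Series n d (HV n d)} (hΦ : Φ ∈ T.formalNbhds) {k j : ι}
    {p : Fin n → ℂ} (hp : p ∈ U.dom k j) (m : ℕ) :
    EqNear 0 p ((Φ k j).trunc m) fun x => (U.φ k j x.1, 0) := by
  refine (Series.eqNear_trunc_of_le (fun Q => hΦ.1 k j Q p hp) (Nat.zero_le m)).trans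
    (EqNear.of_eventuallyEq ?_)
  filter_upwards [eventually_fst_mem (U.isOpen_dom k j) hp] with x hx
  exact trunc_zero_of_mem hΦ hx

theorem nbhd_eqNear_one {Φ : ι → ι → Series n d (HV n d)} (hΦ : Φ ∈ T.formalNbhds) {k j : ι}
    {p : Fin n → ℂ} (hp : p ∈ U.dom k j) {m : ℕ} (hm : 1 ≤ m) :
    EqNear 1 p ((Φ k j).trunc m) fun x =>
      (U.φ k j x.1 + (T.l k j x.1).mulVec x.2, (T.t k j x.1).mulVec x.2) := by
  refine (Series.eqNear_trunc_of_le (fun Q => hΦ.1 k j Q p hp) hm).trans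
    (EqNear.of_eventuallyEq ?_)
  filter_upwards [eventually_fst_mem (U.isOpen_dom k j) hp] with x hx
  exact trunc_one_of_mem hΦ hx

theorem map_trunc_one {F : ι → Series n d (HV n d)} (hF : F ∈ T.formalMaps) {j : ι}
    {x : HV n d} (hx : x.1 ∈ U.img j) : (F j).trunc 1 x = x := by
  rw [Series.trunc_succ, Series.trunc_zero_eq, (hF.2 j x.1 hx).1, zero_add, (hF.2 j x.1 hx).2]
  simp

theorem map_eqNear_one {F : ι → Series n d (HV n d)} (hF : F ∈ T.formalMaps) {j : ι}
    {p : Fin n → ℂ} (hp : p ∈ U.img j) {m : ℕ} (hm : 1 ≤ m) :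
    EqNear 1 p ((F j).trunc m) fun x => x := by
  refine (Series.eqNear_trunc_of_le (fun Q => hF.1 j Q p hp) hm).trans
    (EqNear.of_eventuallyEq ?_)
  filter_upwards [eventually_fst_mem (U.isOpen_img j) hp] with x hx
  exact map_trunc_one hF hx

theorem map_preserves {F : ι → Series n d (HV n d)} (hF : F ∈ T.formalMaps) {j : ι}
    {p : Fin n → ℂ} (hp : p ∈ U.img j) (m : ℕ) : Preserves p p ((F j).trunc m) := by
  refine (Preserves.id p).congr ?_
  have h1 := (map_eqNear_one hF hp (m := m + 1) (by omega)).mono zero_le_one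
  exact ((Series.eqNear_trunc_of_le (fun Q => hF.1 j Q p hp) (Nat.zero_le (m + 1))).symm.trans
    h1).symm.trans (Series.eqNear_trunc_of_le (fun Q => hF.1 j Q p hp) (Nat.zero_le m)).symm

/-! ### Comparison of neighborhoods and conjugacy -/

theorem EqMod.eqNear {m : ℕ} {Φ Ψ : ι → ι → Series n d (HV n d)} (h : T.EqMod m Φ Ψ) {k j : ι}
    {p : Fin n → ℂ} (hp : p ∈ U.dom k j) : EqNear m p ((Φ k j).trunc m) ((Ψ k j).trunc m) := by
  refine EqNear.of_eventuallyEq ?_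
  filter_upwards [eventually_fst_mem (U.isOpen_dom k j) hp] with x hx
  exact Series.trunc_congr fun Q hQ => h k j Q hQ _ hx

theorem EqMod.symm {m : ℕ} {Φ Ψ : ι → ι → Series n d (HV n d)} (h : T.EqMod m Φ Ψ) :
    T.EqMod m Ψ Φ := fun k j Q hQ q hq => (h k j Q hQ q hq).symm

theorem EqMod.trans {m : ℕ} {Φ Ψ Θ : ι → ι → Series n d (HV n d)} (h : T.EqMod m Φ Ψ)
    (h' : T.EqMod m Ψ Θ) : T.EqMod m Φ Θ :=
  fun k j Q hQ q hq => (h k j Q hQ q hq).trans (h' k j Q hQ q hq)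

theorem EqMod.mono {m m' : ℕ} {Φ Ψ : ι → ι → Series n d (HV n d)} (h : T.EqMod m Φ Ψ)
    (hm : m' ≤ m) : T.EqMod m' Φ Ψ := fun k j Q hQ => h k j Q (hQ.trans hm)

theorem EqMod.trunc_sub {m : ℕ} {Φ Ψ : ι → ι → Series n d (HV n d)} (h : T.EqMod m Φ Ψ)
    {k j : ι} {x : HV n d} (hx : x.1 ∈ U.dom k j) :
    (Φ k j).trunc (m + 1) x - (Ψ k j).trunc (m + 1) x
      = (Φ k j - Ψ k j).part (m + 1) x.1 x.2 := by
  rw [Series.trunc_succ, Series.trunc_succ, Series.part_sub,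
    Series.trunc_congr fun Q hQ => h k j Q hQ _ hx]
  abel

theorem EqMod.conjMod {m : ℕ} {F : ι → Series n d (HV n d)} (hF : F ∈ T.formalMaps)
    {Φ Ψ Ψ' : ι → ι → Series n d (HV n d)} (h : T.EqMod m Ψ Ψ') (hc : T.ConjMod m F Φ Ψ) :
    T.ConjMod m F Φ Ψ' := fun k j p hp =>
  (hc k j p hp).trans ((h.eqNear hp).comp (map_preserves hF (Cover.mem_img_of_mem_dom hp) m))

/-- The conjugate `F Φ F⁻¹` is determined by `F` and `Φ`. -/
theorem ConjMod.eqMod {m : ℕ} (hm : 1 ≤ m) {F : ι → Series n d (HV n d)}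
    (hF : F ∈ T.formalMaps) {Φ Ψ Ψ' : ι → ι → Series n d (HV n d)}
    (hΨ : ∀ k j Q, AnalyticOnNhd ℂ (Ψ k j Q) (U.dom k j))
    (hΨ' : ∀ k j Q, AnalyticOnNhd ℂ (Ψ' k j Q) (U.dom k j))
    (hc : T.ConjMod m F Φ Ψ) (hc' : T.ConjMod m F Φ Ψ') : T.EqMod m Ψ Ψ' := by
  intro k j Q hQ p hp
  refine Series.coeff_eq_of_eqNear (fun Q => hΨ k j Q p hp) (fun Q => hΨ' k j Q p hp) ?_ hQ
  exact Series.eqNear_of_comp (Series.analyticAt_trunc (x := (p, 0)) fun Q => hΨ k j Q p hp)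
    (Series.analyticAt_trunc (x := (p, 0)) fun Q => hΨ' k j Q p hp)
    (map_eqNear_one hF (Cover.mem_img_of_mem_dom hp) hm)
    ((hc k j p hp).symm.trans (hc' k j p hp))

/-- `F + [f]^m`. -/
def addPart (m : ℕ) (F f : ι → Series n d (HV n d)) : ι → Series n d (HV n d) :=
  fun j Q h => F j Q h + if ∑ i, Q i = m then f j Q h else 0

theorem addPart_mem {m : ℕ} (hm : 2 ≤ m) {F f : ι → Series n d (HV n d)}
    (hF : F ∈ T.formalMaps)
    (hf : ∀ j Q, ∑ i, Q i = m → AnalyticOnNhd ℂ (f j Q) (U.img j)) :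
    addPart m F f ∈ T.formalMaps := by
  refine ⟨fun j Q q hq => ?_, fun j h hh => ⟨?_, fun v => ?_⟩⟩
  · unfold addPart
    split_ifs with hQ
    · exact (hF.1 j Q q hq).add (hf j Q hQ q hq)
    · exact (hF.1 j Q q hq).add analyticAt_const
  · rw [addPart, if_neg (by simp; omega), add_zero, (hF.2 j h hh).1]
  · rw [← (hF.2 j h hh).2 v]
    refine Series.part_congr (fun Q hQ => ?_) v
    rw [addPart, if_neg (by omega), add_zero]

theorem addPart_trunc (m : ℕ) (F f : ι → Series n d (HV n d)) (j : ι) (x : HV n d) :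
    (addPart (m + 1) F f j).trunc (m + 1) x
      = (F j).trunc (m + 1) x + (f j).part (m + 1) x.1 x.2 := by
  rw [Series.trunc_succ, Series.trunc_succ, add_assoc, ← Series.part_add]
  congr 1
  · exact Series.trunc_congr fun Q hQ => by rw [addPart, if_neg (by omega), add_zero]
  · exact Series.part_congr (fun Q hQ => by rw [addPart, if_pos hQ]; rfl) _

/-! ### Conjugacy and cocycles -/

variable [IsManifold 𝓘(ℂ, Fin n → ℂ) ω C]

theorem nbhd_preserves {Φ : ι → ι → Series n d (HV n d)} (hΦ : Φ ∈ T.formalNbhds) {k j : ι}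
    {p : Fin n → ℂ} (hp : p ∈ U.dom k j) (m : ℕ) :
    Preserves p (U.φ k j p) ((Φ k j).trunc m) := by
  refine Preserves.congr (y := fun x => (U.φ k j x.1, 0)) ⟨?_, by simpa using Vanishes.zero⟩
    (eqNear_def.1 (nbhd_eqNear_zero hΦ hp m).symm)
  exact ((Cover.analyticAt_φ hp).continuousAt.tendsto.comp (tendsto_fst p)).prodMk_nhds
    tendsto_const_nhds

/-- The derivative of `Φ_{kj}` along the zero section is the transition matrix `g_{kj}`. -/
theorem fderiv_nbhd {Φ : ι → ι → Series n d (HV n d)} (hΦ : Φ ∈ T.formalNbhds) {k j : ι}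
    {p : Fin n → ℂ} (hp : p ∈ U.dom k j) {m : ℕ} (hm : 1 ≤ m) (x : HV n d) :
    fderiv ℂ ((Φ k j).trunc m) (p, 0) x = T.g k j p x := by
  have hD := (analyticAt_nbhd hΦ m (x := (p, 0)) hp).differentiableAt.hasFDerivAt
  set D := fderiv ℂ ((Φ k j).trunc m) (p, 0)
  have hx : x = ((x.1, 0) : HV n d) + (0, x.2) := by simp
  have h1 : D (x.1, 0) = (fderiv ℂ (U.φ k j) p x.1, 0) := by
    have e1 : HasFDerivAt (fun q : Fin n → ℂ => (Φ k j).trunc m (q, 0))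
        (D.comp (ContinuousLinearMap.inl ℂ (Fin n → ℂ) (Fin d → ℂ))) p :=
      HasFDerivAt.comp (g := (Φ k j).trunc m) p hD
        (ContinuousLinearMap.inl ℂ (Fin n → ℂ) (Fin d → ℂ)).hasFDerivAt
    have e2 : HasFDerivAt (fun q : Fin n → ℂ => ((U.φ k j q, 0) : HV n d))
        ((fderiv ℂ (U.φ k j) p).prod 0) p :=
      (Cover.analyticAt_φ hp).differentiableAt.hasFDerivAt.prodMk (hasFDerivAt_const _ _)
    have e3 := e1.congr_of_eventuallyEq (f₁ := fun q : Fin n → ℂ => ((U.φ k j q, 0) : HV n d)) (by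
      filter_upwards [(U.isOpen_dom k j).mem_nhds hp] with q hq
      exact (sub_eq_zero.1 ((eqNear_def.1 (nbhd_eqNear_zero hΦ hq m)).apply_zero
        (by simp))).symm)
    exact congrArg (fun L : (Fin n → ℂ) →L[ℂ] HV n d => L x.1) (e3.unique e2)
  have h2 : D (0, x.2) = ((T.l k j p).mulVec x.2, (T.t k j p).mulVec x.2) := by
    have e1 : HasDerivAt (fun s : ℝ => (Φ k j).trunc m (p, (s : ℂ) • x.2)) (D (0, x.2)) 0 := by
      have a1 : HasDerivAt (fun s : ℝ => ((p, (s : ℂ) • x.2) : HV n d)) (0, x.2) 0 := by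
        have := (Complex.ofRealCLM.hasDerivAt (x := (0 : ℝ))).smul_const x.2
        simpa using (hasDerivAt_const (0 : ℝ) p).prodMk this
      have a2 : HasFDerivAt ((Φ k j).trunc m) (D.restrictScalars ℝ) (p, ((0 : ℝ) : ℂ) • x.2) := by
        simpa using hD.restrictScalars ℝ
      exact a2.comp_hasDerivAt (0 : ℝ) a1
    have e2 : HasDerivAt (fun s : ℝ => ((U.φ k j p + (T.l k j p).mulVec ((s : ℂ) • x.2),
        (T.t k j p).mulVec ((s : ℂ) • x.2)) : HV n d))
        ((T.l k j p).mulVec x.2, (T.t k j p).mulVec x.2) 0 := by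
      simp only [Matrix.mulVec_smul]
      have a1 := (Complex.ofRealCLM.hasDerivAt (x := (0 : ℝ))).smul_const
        ((T.l k j p).mulVec x.2)
      have a2 := (Complex.ofRealCLM.hasDerivAt (x := (0 : ℝ))).smul_const
        ((T.t k j p).mulVec x.2)
      simpa using (a1.const_add (U.φ k j p)).prodMk a2
    have e3 := (eqNear_def.1 (nbhd_eqNear_one hΦ hp hm)).ray x.2
    have e4 : HasFDerivAt (fun s : ℝ => (Φ k j).trunc m (p, (s : ℂ) • x.2) -
        ((U.φ k j p + (T.l k j p).mulVec ((s : ℂ) • x.2),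
          (T.t k j p).mulVec ((s : ℂ) • x.2)) : HV n d)) (0 : ℝ →L[ℝ] HV n d) 0 := by
      refine IsBigO.hasFDerivAt (n := 2) ?_ one_lt_two
      simpa using e3.norm_right
    have e5 := e4.hasDerivAt.unique (e1.sub e2)
    rw [_root_.zero_apply, eq_comm, sub_eq_zero] at e5
    exact e5
  rw [hx, map_add, h1, h2]
  simp [g]

theorem ConjMod.mono {m m' : ℕ} {F : ι → Series n d (HV n d)} (hF : F ∈ T.formalMaps)
    {Φ Ψ : ι → ι → Series n d (HV n d)} (hΦ : Φ ∈ T.formalNbhds)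
    (hΨ : ∀ k j Q, AnalyticOnNhd ℂ (Ψ k j Q) (U.dom k j))
    (hc : T.ConjMod m F Φ Ψ) (hm : m' ≤ m) : T.ConjMod m' F Φ Ψ := by
  intro k j p hp
  have hpj := Cover.mem_img_of_mem_dom hp
  have hpk := Cover.φ_mem_img hp
  have e1 := Series.eqNear_trunc_comp (fun Q => hF.1 k Q _ hpk) (fun Q => hΦ.1 k j Q p hp)
    (nbhd_preserves hΦ hp) hm
  have e2 := Series.eqNear_trunc_comp (fun Q => hΨ k j Q _ hp) (fun Q => hF.1 j Q p hpj)
    (map_preserves hF hpj) hm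
  exact (e1.symm.trans ((hc k j p hp).mono hm)).trans e2

/-- Two neighborhoods that agree up to degree `m` differ in degree `m + 1` by a cocycle with
values in `T_C M ⊗ S^{m+1} N_C^*`. -/
theorem sub_mem_Z1 {m : ℕ} (hm : 1 ≤ m) {A B : ι → ι → Series n d (HV n d)}
    (hA : A ∈ T.formalNbhds) (hB : B ∈ T.formalNbhds) (h : T.EqMod m A B) :
    A - B ∈ T.Z1 (m + 1) := by
  have han : ∀ k j Q, AnalyticOnNhd ℂ ((A - B) k j Q) (U.dom k j) := fun k j Q q hq =>
    (hA.1 k j Q q hq).sub (hB.1 k j Q q hq)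
  refine ⟨fun k j Q _ => han k j Q, fun k j i p hp v => ?_⟩
  have hp' := Cover.φ_mem_dom hp
  have hpres := nbhd_preserves hA hp.2 (m + 1)
  have hlead := nbhd_eqNear_one hA hp.2 (m := m + 1) (by omega)
  -- contribution of the outer map: `(A_{kj} - B_{kj}) ∘ A_{ji}`
  have e1 : EqNear (m + 1) p
      (fun x => (A k j).trunc (m + 1) ((A j i).trunc (m + 1) x)
        - (B k j).trunc (m + 1) ((A j i).trunc (m + 1) x))
      fun x => ((A - B) k j).part (m + 1) (U.φ j i x.1) ((T.t j i x.1).mulVec x.2) := by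
    refine EqNear.trans (EqNear.of_eventuallyEq ?_) (Series.eqNear_part_comp
      (fun Q _ => han k j Q _ hp') hpres (b := fun x => (U.φ j i x.1, (T.t j i x.1).mulVec x.2))
      ?_ ?_)
    · filter_upwards [hpres.tendsto.eventually (eventually_fst_mem (U.isOpen_dom k j) hp')]
        with x hx
      exact h.trunc_sub hx
    · exact Vanishes.fst_comp (eqNear_def.1 (nbhd_eqNear_zero hA hp.2 (m + 1)))
    · exact Vanishes.snd_comp (eqNear_def.1 hlead)
  -- contribution of the inner map: the linearization of `B_{kj}`
  have hdiff : ∀ᶠ x : HV n d in 𝓝 (p, 0),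
      (A j i).trunc (m + 1) x - (B j i).trunc (m + 1) x
        = ((A - B) j i).part (m + 1) x.1 x.2 := by
    filter_upwards [eventually_fst_mem (U.isOpen_dom j i) hp.2] with x hx
    exact h.trunc_sub hx
  have e2 : EqNear (m + 1) p (fun x => (B k j).trunc (m + 1) ((A j i).trunc (m + 1) x))
      fun x => (B k j).trunc (m + 1) ((B j i).trunc (m + 1) x)
        + T.g k j (U.φ j i x.1) (((A - B) j i).part (m + 1) x.1 x.2) := by
    have hw : Vanishes (m + 1) p fun x =>
        (A j i).trunc (m + 1) x - (B j i).trunc (m + 1) x :=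
      (Series.vanishes_part fun Q _ => han j i Q p hp.2).congr'
        (hdiff.mono fun x hx => hx.symm)
    refine (eqNear_add_fderiv (m := m + 1) (by omega) (analyticAt_nbhd hB (m + 1) hp')
      (nbhd_preserves hB hp.2 (m + 1)).tendsto (b := fun x => (U.φ j i x.1, 0))
      (eqNear_def.1 (nbhd_eqNear_zero hB hp.2 (m + 1))) hw).trans (EqNear.of_eventuallyEq ?_)
    have hφ : Tendsto (fun x : HV n d => U.φ j i x.1) (𝓝 (p, 0)) (𝓝 (U.φ j i p)) :=
      (Cover.analyticAt_φ hp.2).continuousAt.tendsto.comp (tendsto_fst p)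
    filter_upwards [hdiff, hφ.eventually ((U.isOpen_dom k j).mem_nhds hp')] with x hx hx'
    rw [hx, fderiv_nbhd hB hx' (by omega)]
  have e3 := hA.2.2 k j i p hp (m + 1)
  have e4 := hB.2.2 k j i p hp (m + 1)
  have hki : ∀ᶠ x : HV n d in 𝓝 (p, 0),
      (A k i).trunc (m + 1) x - (B k i).trunc (m + 1) x
        = ((A - B) k i).part (m + 1) x.1 x.2 := by
    filter_upwards [eventually_fst_mem (U.isOpen_dom k i) hp.1] with x hx
    exact h.trunc_sub hx
  have key : Vanishes (m + 1 + 1) p fun x : HV n d => ((A - B) k i).part (m + 1) x.1 x.2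
      - (((A - B) k j).part (m + 1) (U.φ j i x.1) ((T.t j i x.1).mulVec x.2)
        + T.g k j (U.φ j i x.1) (((A - B) j i).part (m + 1) x.1 x.2)) := by
    have := (((eqNear_def.1 e1).add (eqNear_def.1 e2)).sub (eqNear_def.1 e3)).add
      (eqNear_def.1 e4)
    refine this.congr' ?_
    filter_upwards [hki] with x hx
    rw [← hx]
    abel
  refine sub_eq_zero.1 (Series.eq_zero_of_homogeneous (p := p) (m := m + 1)
    (P := fun x : HV n d => ((A - B) k i).part (m + 1) x.1 x.2
      - (((A - B) k j).part (m + 1) (U.φ j i x.1) ((T.t j i x.1).mulVec x.2)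
        + T.g k j (U.φ j i x.1) (((A - B) j i).part (m + 1) x.1 x.2))) (fun c v => ?_) key v)
  simp only [Matrix.mulVec_smul, Series.part_arg_smul, map_smul, smul_sub, smul_add]

/-- A coboundary in degree `m + 1` can be removed by changing the formal map in degree `m + 1`. -/
theorem conjMod_addPart {m : ℕ} (hm : 1 ≤ m) {Φ Ψ N : ι → ι → Series n d (HV n d)}
    {F f : ι → Series n d (HV n d)} (hΦ : Φ ∈ T.formalNbhds) (hΨ : Ψ ∈ T.formalNbhds)
    (hN : ∀ k j Q, AnalyticOnNhd ℂ (N k j Q) (U.dom k j)) (hF : F ∈ T.formalMaps)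
    (hc : T.ConjMod (m + 1) F Φ Ψ) (hΨN : T.EqMod m Ψ N)
    (hf : ∀ j Q, ∑ i, Q i = m + 1 → AnalyticOnNhd ℂ (f j Q) (U.img j))
    (heq : ∀ k j, ∀ h ∈ U.dom k j, ∀ v, (Ψ k j - N k j).part (m + 1) h v
      = T.g k j h ((f j).part (m + 1) h v)
        - (f k).part (m + 1) (U.φ k j h) ((T.t k j h).mulVec v)) :
    T.ConjMod (m + 1) (addPart (m + 1) F f) Φ N := by
  intro k j p hp
  have hpj := Cover.mem_img_of_mem_dom hp
  have hpk := Cover.φ_mem_img hp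
  have hF' := addPart_mem (T := T) (m := m + 1) (by omega) hF hf
  have hpres := map_preserves hF' hpj (m + 1)
  have e1 : EqNear (m + 1) p
      (fun x => (f k).part (m + 1) ((Φ k j).trunc (m + 1) x).1 ((Φ k j).trunc (m + 1) x).2)
      fun x => (f k).part (m + 1) (U.φ k j x.1) ((T.t k j x.1).mulVec x.2) :=
    Series.eqNear_part_comp (fun Q hQ => hf k Q hQ _ hpk) (nbhd_preserves hΦ hp (m + 1))
      (b := fun x => (U.φ k j x.1, (T.t k j x.1).mulVec x.2))
      (Vanishes.fst_comp (eqNear_def.1 (nbhd_eqNear_zero hΦ hp (m + 1))))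
      (Vanishes.snd_comp (eqNear_def.1 (nbhd_eqNear_one hΦ hp (m := m + 1) (by omega))))
  have e2 : EqNear (m + 1) p
      (fun x => (Ψ k j).trunc (m + 1) ((addPart (m + 1) F f j).trunc (m + 1) x))
      fun x => (Ψ k j).trunc (m + 1) ((F j).trunc (m + 1) x)
        + T.g k j x.1 ((f j).part (m + 1) x.1 x.2) := by
    refine (eqNear_add_fderiv (m := m + 1) (by omega) (analyticAt_nbhd hΨ (m + 1)
      (x := (p, 0)) hp) (map_preserves hF hpj (m + 1)).tendsto (b := fun x => (x.1, 0)) ?_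
      ?_).trans (EqNear.of_eventuallyEq ?_)
    · have h1 := (map_eqNear_one hF hpj (m := m + 1) (by omega)).mono zero_le_one
      refine ((eqNear_def.1 h1).add ?_ : Vanishes 1 p fun x => _ + ((0, x.2) : HV n d)).congr'
        (.of_forall fun x => ?_)
      · exact Vanishes.zero.prodMk (Preserves.id p).snd
      · ext <;> simp
    · simp only [addPart_trunc, add_sub_cancel_left]
      exact Series.vanishes_part fun Q hQ => hf j Q hQ _ hpj
    · filter_upwards [eventually_fst_mem (U.isOpen_dom k j) hp] with x hx
      rw [addPart_trunc, add_sub_cancel_left, fderiv_nbhd hΨ hx (by omega)]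
  have e3 : EqNear (m + 1) p
      (fun x => (Ψ k j).trunc (m + 1) ((addPart (m + 1) F f j).trunc (m + 1) x)
        - (N k j).trunc (m + 1) ((addPart (m + 1) F f j).trunc (m + 1) x))
      fun x => (Ψ k j - N k j).part (m + 1) x.1 x.2 := by
    refine EqNear.trans (EqNear.of_eventuallyEq ?_) (Series.eqNear_part_comp (a := Ψ k j - N k j)
      (fun Q _ => (hΨ.1 k j Q p hp).sub (hN k j Q p hp)) hpres (b := fun x => x) ?_ ?_)
    · filter_upwards [hpres.tendsto.eventually (eventually_fst_mem (U.isOpen_dom k j) hp)]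
        with x hx
      exact hΨN.trunc_sub hx
    · exact Vanishes.fst_comp (eqNear_def.1
        ((map_eqNear_one hF' hpj (m := m + 1) (by omega)).mono zero_le_one))
    · exact Vanishes.snd_comp (eqNear_def.1 (map_eqNear_one hF' hpj (m := m + 1) (by omega)))
  have := (((eqNear_def.1 (hc k j p hp)).add (eqNear_def.1 e1)).sub (eqNear_def.1 e2)).add
    (eqNear_def.1 e3)
  refine this.congr' ?_
  filter_upwards [eventually_fst_mem (U.isOpen_dom k j) hp] with x hx
  rw [heq k j x.1 hx x.2, addPart_trunc (F := F) (j := k)]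
  abel

/-- An automorphism of `N` to order `m + 1` acts trivially, to that order, on the neighborhoods
that agree with `N` up to degree `m`. -/
theorem eqMod_of_aut {m : ℕ} (hm : 1 ≤ m) {A B N : ι → ι → Series n d (HV n d)}
    {F : ι → Series n d (HV n d)} (hA : A ∈ T.formalNbhds) (hB : B ∈ T.formalNbhds)
    (hN : N ∈ T.formalNbhds) (hAN : T.EqMod m A N) (hBN : T.EqMod m B N)
    (hF : F ∈ T.Aut (m + 1) N) (hc : T.ConjMod (m + 1) F A B) : T.EqMod (m + 1) A B := by
  have hF1 := hF.1
  -- `F ∘ A - A = F ∘ N - N` and `B ∘ F - B = N ∘ F - N`, modulo `O(m + 2)`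
  intro k j Q hQ p hp
  have hpj := Cover.mem_img_of_mem_dom hp
  have hpk := Cover.φ_mem_img hp
  have hdiff : ∀ {A : ι → ι → Series n d (HV n d)}, A ∈ T.formalNbhds → T.EqMod m A N →
      Vanishes (m + 1) p fun x => (A k j).trunc (m + 1) x - (N k j).trunc (m + 1) x := by
    intro A hA hAN
    refine (Series.vanishes_part (a := A k j - N k j) fun Q _ =>
      (hA.1 k j Q p hp).sub (hN.1 k j Q p hp)).congr' ?_
    filter_upwards [eventually_fst_mem (U.isOpen_dom k j) hp] with x hx
    exact (hAN.trunc_sub hx).symm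
  have hid : ∀ q ∈ U.img k, ∀ x, fderiv ℂ ((F k).trunc (m + 1)) (q, 0) x = x := by
    intro q hq x
    rw [(Series.hasFDerivAt_of_eqNear_one
      (map_eqNear_one hF1 hq (m := m + 1) (by omega))).fderiv]
    rfl
  have e1 : EqNear (m + 1) p (fun x => (F k).trunc (m + 1) ((A k j).trunc (m + 1) x))
      fun x => (F k).trunc (m + 1) ((N k j).trunc (m + 1) x)
        + ((A k j).trunc (m + 1) x - (N k j).trunc (m + 1) x) := by
    refine (eqNear_add_fderiv (m := m + 1) (by omega) (analyticAt_map hF1 (m + 1)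
      (x := (U.φ k j p, 0)) hpk) (nbhd_preserves hN hp (m + 1)).tendsto
      (b := fun x => (U.φ k j x.1, 0))
      (eqNear_def.1 (nbhd_eqNear_zero hN hp (m + 1))) (hdiff hA hAN)).trans
      (EqNear.of_eventuallyEq ?_)
    filter_upwards [eventually_fst_mem (U.isOpen_dom k j) hp] with x hx
    rw [hid _ (Cover.φ_mem_img hx)]
  have e2 := Series.vanishes_comp_sub (F := (F j).trunc (m + 1))
    ((analyticAt_nbhd hB (m + 1) (x := (p, 0)) hp).sub
    (analyticAt_nbhd hN (m + 1) (x := (p, 0)) hp)) (hdiff hB hBN)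
    (map_eqNear_one hF1 hpj (by omega))
  refine Series.coeff_eq_of_eqNear (fun Q => hA.1 k j Q p hp) (fun Q => hB.1 k j Q p hp) ?_ hQ
  have := (((eqNear_def.1 (hc k j p hp)).sub (eqNear_def.1 e1)).sub
    (eqNear_def.1 (hF.2 k j p hp))).add (eqNear_def.1 e2)
  refine this.congr' (.of_forall fun x => ?_)
  simp only [Pi.sub_apply]
  abel

end TangentBundleData

/-! ### Conjugation of neighborhoods by formal maps -/

section Solve

variable {n d : ℕ} {E : Type*} [NormedAddCommGroup E] [NormedSpace ℂ E] [CompleteSpace E]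

theorem Preserves.apply_eq {p p' : Fin n → ℂ} {y : HV n d → HV n d} (hy : Preserves p p' y)
    (hc : ContinuousAt y (p, 0)) : y (p, 0) = (p', 0) :=
  tendsto_nhds_unique hc.tendsto hy.tendsto

/-- The equation `f ∘ F = A + O(m)` has an analytic solution `f`.  Each correction
`f ↦ f + (A - f ∘ F)` improves the order by one, because `F` is tangent to the identity. -/
theorem exists_comp_eq {D : Set (Fin n → ℂ)} {F : HV n d → HV n d} {A : HV n d → E}
    (hF : ∀ p ∈ D, AnalyticAt ℂ F (p, 0)) (hF1 : ∀ p ∈ D, EqNear 1 p F fun x => x)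
    (hA : ∀ p ∈ D, AnalyticAt ℂ A (p, 0)) (m : ℕ) :
    ∃ f : HV n d → E, ∀ p ∈ D, AnalyticAt ℂ f (p, 0) ∧
      Vanishes m p fun x => A x - f (F x) := by
  induction m with
  | zero =>
    refine ⟨fun _ => 0, fun p hp => ⟨analyticAt_const, ?_⟩⟩
    simpa using Vanishes.of_continuousAt (hA p hp).continuousAt
  | succ m ih =>
    obtain ⟨f, hf⟩ := ih
    have hR : ∀ p ∈ D, AnalyticAt ℂ (fun x => A x - f (F x)) (p, 0) := by
      intro p hp
      have h0 : F (p, 0) = (p, 0) := sub_eq_zero.1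
        ((eqNear_def.1 (hF1 p hp)).apply_zero two_ne_zero)
      exact (hA p hp).sub (AnalyticAt.fun_comp (g := f) (by rw [h0]; exact (hf p hp).1) (hF p hp))
    refine ⟨fun x => f x + (A x - f (F x)), fun p hp => ⟨(hf p hp).1.add (hR p hp), ?_⟩⟩
    have := eqNear_def.1 (Series.vanishes_comp_sub (hR p hp) (hf p hp).2 (hF1 p hp)).symm
    refine this.congr' (.of_forall fun x => ?_)
    simp only
    abel

/-- The series solution `Ψ` of `Ψ ∘ F = A`, where `A` is given by compatible jets. -/
theorem exists_series_comp_eq {D : Set (Fin n → ℂ)} (hD : IsOpen D) {F : Series n d (HV n d)}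
    {A : ℕ → HV n d → E} (hF : ∀ Q, AnalyticOnNhd ℂ (F Q) D)
    (hF1 : ∀ p ∈ D, ∀ m, 1 ≤ m → EqNear 1 p (F.trunc m) fun x => x)
    (hA : ∀ p ∈ D, ∀ m, AnalyticAt ℂ (A m) (p, 0))
    (hAA : ∀ p ∈ D, ∀ m, EqNear m p (A (m + 1)) (A m)) :
    ∃ Ψ : Series n d E, (∀ Q, AnalyticOnNhd ℂ (Ψ Q) D) ∧
      ∀ p ∈ D, ∀ m, EqNear m p (fun x => Ψ.trunc m (F.trunc m x)) (A m) := by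
  have hFan : ∀ m, ∀ p ∈ D, AnalyticAt ℂ (F.trunc m) (p, 0) := fun m p hp =>
    Series.analyticAt_trunc fun Q => hF Q p hp
  have hex := fun m => exists_comp_eq (F := F.trunc (m + 1)) (A := A m) (hFan (m + 1))
    (fun p hp => hF1 p hp (m + 1) (by omega)) (fun p hp => hA p hp m) (m + 1)
  choose f hf using hex
  have hf1 : ∀ m, ∀ p ∈ D, AnalyticAt ℂ (f m) (p, 0) := fun m p hp => (hf m p hp).1
  have hf2 : ∀ m, ∀ p ∈ D, EqNear m p (fun x => f m (F.trunc (m + 1) x)) (A m) :=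
    fun m p hp => (eqNear_def.2 (hf m p hp).2).symm
  have hpres : ∀ m, ∀ p ∈ D, Preserves p p (F.trunc m) := by
    intro m p hp
    have h1 := (hF1 p hp (m + 1) (by omega)).mono zero_le_one
    have h2 := Series.eqNear_trunc_of_le (fun Q => hF Q p hp) (Nat.zero_le (m + 1))
    have h3 := Series.eqNear_trunc_of_le (fun Q => hF Q p hp) (Nat.zero_le m)
    exact (Preserves.id p).congr (eqNear_def.1 ((h1.symm.trans h2).trans h3.symm))
  have hchange : ∀ m, ∀ p ∈ D, ∀ k, m ≤ k →
      EqNear m p (fun x => f m (F.trunc k x)) fun x => f m (F.trunc m x) :=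
    fun m p hp k hk => (Series.eqNear_trunc_of_le (fun Q => hF Q p hp) hk).analytic_comp
      (hf1 m p hp) (hpres k p hp).tendsto (hpres m p hp).tendsto
  have hstep : ∀ m, ∀ p ∈ D, EqNear m p (f (m + 1)) (f m) := by
    intro m p hp
    refine Series.eqNear_of_comp (hf1 _ p hp) (hf1 _ p hp) (hF1 p hp (m + 2) (by omega)) ?_
    exact ((((hf2 (m + 1) p hp).mono (Nat.le_succ m)).trans (hAA p hp m)).trans
      (hf2 m p hp).symm).trans ((hchange m p hp (m + 1) (by omega)).trans
        (hchange m p hp (m + 2) (by omega)).symm)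
  have hstep' : ∀ m k, m ≤ k → ∀ p ∈ D, EqNear m p (f k) (f m) := by
    intro m k hk p hp
    induction k, hk using Nat.le_induction with
    | base => exact EqNear.refl _
    | succ k hk ih => exact ((hstep k p hp).mono hk).trans ih
  have hcoef : ∀ m, ∀ p ∈ D, ∀ Q : Fin d → ℕ, ∑ i, Q i ≤ m →
      taylor (f m) Q p = taylor (f (∑ i, Q i)) Q p := fun m p hp Q hQ =>
    Series.coeff_eq_of_eqNear (analyticAt_taylor (hf1 _ p hp)) (analyticAt_taylor (hf1 _ p hp))
      ((((eqNear_taylor (hf1 _ p hp) _).symm.trans (hstep' _ _ hQ p hp))).trans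
        (eqNear_taylor (hf1 _ p hp) _)) le_rfl
  -- the coefficient of `v^Q` is taken from the solution modulo `O(|Q| + 1)`
  refine ⟨fun Q => taylor (f (∑ i, Q i)) Q, fun Q p hp => analyticAt_taylor (hf1 _ p hp) Q,
    fun p hp m => ?_⟩
  have h1 : EqNear m p (Series.trunc (fun Q => taylor (f (∑ i, Q i)) Q) m) (f m) := by
    refine (EqNear.of_eventuallyEq ?_).trans (eqNear_taylor (hf1 m p hp) m).symm
    filter_upwards [eventually_fst_mem hD hp] with x hx
    exact Series.trunc_congr fun Q hQ => (hcoef m x.1 hx Q hQ).symm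
  exact (h1.comp (hpres m p hp)).trans
    ((hchange m p hp (m + 1) (by omega)).symm.trans (hf2 m p hp))

/-- Maps that are tangent to the identity along the zero section have analytic local inverses. -/
theorem exists_analyticAt_leftInverse {F : HV n d → HV n d} {p : Fin n → ℂ}
    (hF : AnalyticAt ℂ F (p, 0)) (hF1 : EqNear 1 p F fun x => x) :
    ∃ G : HV n d → HV n d, AnalyticAt ℂ G (p, 0) ∧ ∀ᶠ x in 𝓝 (p, 0), G (F x) = x := by
  have h0 : F (p, 0) = (p, 0) := sub_eq_zero.1 ((eqNear_def.1 hF1).apply_zero two_ne_zero)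
  have hd := (Series.hasFDerivAt_of_eqNear_one hF1).fderiv
  have hs : HasStrictFDerivAt F
      ((ContinuousLinearEquiv.refl ℂ (HV n d) : HV n d ≃L[ℂ] HV n d) : HV n d →L[ℂ] HV n d)
      (p, 0) := by
    have := hF.hasStrictFDerivAt
    rw [hd] at this
    exact this
  refine ⟨hs.localInverse, ?_, hs.eventually_left_inverse⟩
  have := (hs.toOpenPartialHomeomorph F).analyticAt_symm' (a := (p, 0))
    (i := ContinuousLinearEquiv.refl ℂ (HV n d)) hs.mem_toOpenPartialHomeomorph_source
    (by simpa using hF) (by simpa using hd)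
  rw [HasStrictFDerivAt.localInverse_def]
  simpa [h0] using this

end Solve

namespace TangentBundleData

variable {n d : ℕ} {C : Type*} [TopologicalSpace C] [ChartedSpace (Fin n → ℂ) C] {ι : Type*}
  {U : Cover n C ι} {T : TangentBundleData U d}

/-- The formal map `[F]^{≤ M}`, polynomial in `v`. -/
def truncMap (M : ℕ) (F : ι → Series n d (HV n d)) : ι → Series n d (HV n d) :=
  fun j Q h => if ∑ i, Q i ≤ M then F j Q h else 0

theorem truncMap_mem {M : ℕ} (hM : 1 ≤ M) {F : ι → Series n d (HV n d)}
    (hF : F ∈ T.formalMaps) : truncMap M F ∈ T.formalMaps := by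
  refine ⟨fun j Q q hq => ?_, fun j h hh => ⟨?_, fun v => ?_⟩⟩
  · unfold truncMap
    split_ifs with hQ
    · exact hF.1 j Q q hq
    · exact analyticAt_const
  · rw [truncMap, if_pos (by simp), (hF.2 j h hh).1]
  · rw [← (hF.2 j h hh).2 v]
    exact Series.part_congr (fun Q hQ => by rw [truncMap, if_pos (hQ.le.trans hM)]) v

theorem truncMap_trunc {M m : ℕ} (hm : m ≤ M) (F : ι → Series n d (HV n d)) (j : ι) :
    (truncMap M F j).trunc m = (F j).trunc m :=
  funext fun _ => Series.trunc_congr fun _ hQ => if_pos (hQ.trans hm)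

theorem truncMap_trunc_of_le {M m : ℕ} (hm : M ≤ m) (F : ι → Series n d (HV n d)) (j : ι) :
    (truncMap M F j).trunc m = (truncMap M F j).trunc M := by
  induction m, hm using Nat.le_induction with
  | base => rfl
  | succ m hm ih =>
    funext x
    rw [Series.trunc_succ, ih, add_eq_left]
    refine Finset.sum_eq_zero fun Q hQ => ?_
    have hQ' : ∑ i, Q i = m + 1 := (Finset.mem_piAntidiag.1 hQ).1
    rw [truncMap, if_neg (by omega), smul_zero]

variable [IsManifold 𝓘(ℂ, Fin n → ℂ) ω C]

/-- The conjugate `Ψ = F Φ F⁻¹` of a formal neighborhood by a formal map. -/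
theorem exists_conj {F : ι → Series n d (HV n d)} (hF : F ∈ T.formalMaps)
    {Φ : ι → ι → Series n d (HV n d)} (hΦ : Φ ∈ T.formalNbhds) :
    ∃ Ψ ∈ T.formalNbhds, ∀ m, T.ConjMod m F Φ Ψ := by
  have hex := fun k j => exists_series_comp_eq (U.isOpen_dom k j) (F := F j)
    (A := fun m x => (F k).trunc m ((Φ k j).trunc m x))
    (fun Q q hq => hF.1 j Q q (Cover.mem_img_of_mem_dom hq))
    (fun p hp m hm => map_eqNear_one hF (Cover.mem_img_of_mem_dom hp) hm)
    (fun p hp m => AnalyticAt.fun_comp (g := (F k).trunc m) (by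
        rw [(nbhd_preserves hΦ hp m).apply_eq
          (analyticAt_nbhd hΦ m (x := (p, 0)) hp).continuousAt]
        exact analyticAt_map hF m (Cover.φ_mem_img hp))
      (analyticAt_nbhd hΦ m (x := (p, 0)) hp))
    (fun p hp m => Series.eqNear_trunc_comp (fun Q => hF.1 k Q _ (Cover.φ_mem_img hp))
      (fun Q => hΦ.1 k j Q p hp) (nbhd_preserves hΦ hp) (Nat.le_succ m))
  choose Ψ hΨ hc using hex
  have hconj : ∀ m, T.ConjMod m F Φ Ψ := fun m k j p hp => (hc k j p hp m).symm
  -- `F` is the identity to first order, so `Ψ` has the same leading terms as `Φ`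
  have h1 : T.EqMod 1 Φ Ψ := by
    intro k j Q hQ p hp
    refine Series.coeff_eq_of_eqNear (fun Q => hΦ.1 k j Q p hp) (fun Q => hΨ k j Q p hp) ?_ hQ
    refine EqNear.trans ?_ ((hconj 1 k j p hp).trans (EqNear.of_eventuallyEq ?_))
    · refine EqNear.of_eventuallyEq ?_
      filter_upwards [(nbhd_preserves hΦ hp 1).tendsto.eventually
        (eventually_fst_mem (U.isOpen_img k) (Cover.φ_mem_img hp))] with x hx
      exact (map_trunc_one hF hx).symm
    · filter_upwards [eventually_fst_mem (U.isOpen_img j) (Cover.mem_img_of_mem_dom hp)]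
        with x hx
      rw [map_trunc_one hF hx]
  have hpres : ∀ k j, ∀ p ∈ U.dom k j, ∀ m, Preserves p (U.φ k j p) ((Ψ k j).trunc m) := by
    intro k j p hp m
    refine (nbhd_preserves hΦ hp 0).congr (eqNear_def.1 (((h1.mono zero_le_one).eqNear hp).trans
      (Series.eqNear_trunc_of_le (fun Q => hΨ k j Q p hp) (Nat.zero_le m)).symm))
  refine ⟨Ψ, ⟨hΨ, fun k j h hh => ⟨?_, fun v => ?_⟩, fun k j i p hp m => ?_⟩, hconj⟩
  · rw [← h1 k j 0 (by simp) h hh, (hΦ.2.1 k j h hh).1]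
  · rw [← (hΦ.2.1 k j h hh).2 v]
    exact Series.part_congr (fun Q hQ => (h1 k j Q hQ.le h hh).symm) v
  · have hp' := Cover.φ_mem_dom hp
    have hpi := Cover.mem_img_of_mem_dom hp.1
    -- both sides agree after composition with `F_i`
    have key : EqNear (m + 1) p
        (fun x => (Ψ k j).trunc (m + 1) ((Ψ j i).trunc (m + 1) x)) ((Ψ k i).trunc (m + 1)) := by
      refine Series.eqNear_of_comp ?_ (Series.analyticAt_trunc (x := (p, 0))
        fun Q => hΨ k i Q p hp.1) (map_eqNear_one hF hpi (m := m + 1) (by omega)) ?_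
      · have hin : AnalyticAt ℂ ((Ψ j i).trunc (m + 1)) (p, 0) :=
          Series.analyticAt_trunc (x := (p, 0)) fun Q => hΨ j i Q p hp.2
        refine AnalyticAt.fun_comp (g := (Ψ k j).trunc (m + 1)) ?_ hin
        rw [(hpres j i p hp.2 (m + 1)).apply_eq hin.continuousAt]
        exact Series.analyticAt_trunc fun Q => hΨ k j Q _ hp'
      · have hF' := map_preserves hF hpi (m + 1)
        have a1 := (hconj (m + 1) j i p hp.2).symm.analytic_comp
          (F := (Ψ k j).trunc (m + 1)) (x₀ := (U.φ j i p, 0))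
          (Series.analyticAt_trunc fun Q => hΨ k j Q _ hp')
          ((hpres j i p hp.2 (m + 1)).comp hF').tendsto
          ((map_preserves hF (Cover.φ_mem_img hp.2) (m + 1)).comp
            (nbhd_preserves hΦ hp.2 (m + 1))).tendsto
        have a2 := (hconj (m + 1) k j _ hp').symm.comp (nbhd_preserves hΦ hp.2 (m + 1))
        have a3 := (hΦ.2.2 k j i p hp (m + 1)).analytic_comp (F := (F k).trunc (m + 1))
          (x₀ := (U.φ k i p, 0)) (analyticAt_map hF (m + 1) (Cover.φ_mem_img hp.1))
          (by
            have := (nbhd_preserves hΦ hp' (m + 1)).comp (nbhd_preserves hΦ hp.2 (m + 1))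
            rw [Cover.φ_φ hp.2] at this
            exact this.tendsto)
          (nbhd_preserves hΦ hp.1 (m + 1)).tendsto
        exact ((a1.trans a2).trans a3).trans (hconj (m + 1) k i p hp.1)
    exact (Series.eqNear_trunc_comp (fun Q => hΨ k j Q _ hp') (fun Q => hΨ j i Q p hp.2)
      (hpres j i p hp.2) (Nat.le_succ m)).symm.trans ((key.mono (Nat.le_succ m)).trans
      (Series.eqNear_trunc_of_le (fun Q => hΨ k i Q p hp.1) (Nat.le_succ m)))

/-- Conjugation by a map that is polynomial in `v` preserves convergence. -/
theorem conj_mem_holNbhds {M : ℕ} (hM : 1 ≤ M) {F : ι → Series n d (HV n d)}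
    (hF : F ∈ T.formalMaps) {Φ Ψ : ι → ι → Series n d (HV n d)} (hΦ : Φ ∈ T.holNbhds)
    (hΨ : Ψ ∈ T.formalNbhds) (hc : ∀ m, T.ConjMod m (truncMap M F) Φ Ψ) : Ψ ∈ T.holNbhds := by
  refine ⟨hΨ, fun k j p hp => ?_⟩
  have hF' := truncMap_mem (T := T) hM hF
  have hpj := Cover.mem_img_of_mem_dom hp
  have hpk := Cover.φ_mem_img hp
  obtain ⟨f, hf, hfΦ⟩ := hΦ.2 k j p hp
  have hFan := analyticAt_map hF' M (x := (p, 0)) hpj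
  have hF1 := map_eqNear_one hF' hpj hM
  obtain ⟨G, hG, hGF⟩ := exists_analyticAt_leftInverse hFan hF1
  have hFp : (truncMap M F j).trunc M (p, 0) = (p, 0) :=
    (map_preserves hF' hpj M).apply_eq hFan.continuousAt
  have hGp : G (p, 0) = (p, 0) := by simpa [hFp] using hGF.self_of_nhds
  have hfpres : Preserves p (U.φ k j p) f :=
    (nbhd_preserves hΦ.1 hp 0).congr (eqNear_def.1 (hfΦ 0).symm)
  have hfp : f (p, 0) = (U.φ k j p, 0) := hfpres.apply_eq hf.continuousAt
  have hfG : AnalyticAt ℂ (fun x => f (G x)) (p, 0) :=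
    AnalyticAt.fun_comp (g := f) (by rwa [hGp]) hG
  have han : AnalyticAt ℂ (fun x => (truncMap M F k).trunc M (f (G x))) (p, 0) := by
    refine AnalyticAt.fun_comp (g := (truncMap M F k).trunc M) ?_ hfG
    simp only [hGp, hfp]
    exact analyticAt_map hF' M hpk
  refine ⟨_, han, fun m => ?_⟩
  have hFm : ∀ i, (truncMap M F i).trunc (m + M) = (truncMap M F i).trunc M :=
    fun i => truncMap_trunc_of_le (Nat.le_add_left M m) F i
  have key : EqNear (m + M) p (fun x => (truncMap M F k).trunc M (f (G x)))
      ((Ψ k j).trunc (m + M)) := by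
    refine Series.eqNear_of_comp han (analyticAt_nbhd hΨ (m + M) (x := (p, 0)) hp) hF1 ?_
    have e1 := (hfΦ (m + M)).analytic_comp (F := (truncMap M F k).trunc M)
      (x₀ := (U.φ k j p, 0)) (analyticAt_map hF' M hpk) hfpres.tendsto
      (nbhd_preserves hΦ.1 hp (m + M)).tendsto
    have e2 := hc (m + M) k j p hp
    simp only [hFm] at e2
    refine EqNear.trans (EqNear.of_eventuallyEq ?_) (e1.trans e2)
    filter_upwards [hGF] with x hx
    rw [hx]
  exact (key.mono (Nat.le_add_right m M)).trans
    (Series.eqNear_trunc_of_le (fun Q => hΨ.1 k j Q p hp) (Nat.le_add_right m M))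

/-- Within either class of neighborhoods, conjugation by `F` is possible to any finite order. -/
theorem exists_conj_mem {𝓜 : Set (ι → ι → Series n d (HV n d))}
    (h𝓜 : 𝓜 = T.holNbhds ∨ 𝓜 = T.formalNbhds) {m : ℕ} (hm : 1 ≤ m)
    {F : ι → Series n d (HV n d)} (hF : F ∈ T.formalMaps)
    {Φ : ι → ι → Series n d (HV n d)} (hΦ : Φ ∈ 𝓜) : ∃ Ψ ∈ 𝓜, T.ConjMod m F Φ Ψ := by
  have hΦ' : Φ ∈ T.formalNbhds := by
    rcases h𝓜 with rfl | rfl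
    exacts [hΦ.1, hΦ]
  -- truncate `F`, so that the conjugate of a holomorphic neighborhood converges
  obtain ⟨Ψ, hΨ, hc⟩ := exists_conj (truncMap_mem hm hF) hΦ'
  refine ⟨Ψ, ?_, fun k j p hp => ?_⟩
  · rcases h𝓜 with rfl | rfl
    exacts [conj_mem_holNbhds hm hF hΦ hΨ hc, hΨ]
  · have := hc m k j p hp
    simpa only [truncMap_trunc le_rfl] using this

end TangentBundleData

namespace TangentBundleData

variable {n d : ℕ} {C : Type*} [TopologicalSpace C] [ChartedSpace (Fin n → ℂ) C] {ι : Type*}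
  {U : Cover n C ι} {T : TangentBundleData U d}

/-! ### Foliated neighborhoods -/

theorem IsFoliated.fst_trunc {Φ : ι → ι → Series n d (HV n d)} (hΦ : T.IsFoliated Φ) {k j : ι}
    (m : ℕ) {x : HV n d} (hx : x.1 ∈ U.dom k j) : ((Φ k j).trunc m x).1 = U.φ k j x.1 := by
  induction m with
  | zero => rw [Series.trunc_zero_eq, (hΦ k j x.1 hx).1]
  | succ m ih =>
    rw [Series.trunc_succ, Prod.fst_add, ih, Series.fst_part, add_eq_left]
    refine Finset.sum_eq_zero fun Q hQ => ?_
    have hQ' : ∑ i, Q i = m + 1 := (Finset.mem_piAntidiag.1 hQ).1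
    have h0 := (hΦ k j x.1 hx).2 Q (by rintro rfl; simp at hQ')
    simp only [h0, smul_zero]

/-- The terms of degree at most one of a neighborhood are those prescribed by `T_C M`. -/
theorem EqMod.eqMod_one {Φ Ψ : ι → ι → Series n d (HV n d)} (hΦ : Φ ∈ T.formalNbhds)
    (hΨ : Ψ ∈ T.formalNbhds) : T.EqMod 1 Φ Ψ := by
  intro k j Q hQ p hp
  rcases Nat.le_one_iff_eq_zero_or_eq_one.1 hQ with h | h
  · obtain rfl : Q = 0 := by
      funext i
      exact Finset.sum_eq_zero_iff.1 h i (Finset.mem_univ i)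
    rw [(hΦ.2.1 k j p hp).1, (hΨ.2.1 k j p hp).1]
  · exact Series.coeff_eq_of_part (fun v => by
      rw [(hΦ.2.1 k j p hp).2, (hΨ.2.1 k j p hp).2]) h

/-- The formal map `(h, v) ↦ (H(h, v), v)`.  The coefficient of `v^Q` in the vertical component is
the basis vector `e_i` if `Q` is the multi-index of `v_i`, and zero otherwise. -/
def mapOfIntegral (H : ι → Series n d (Fin n → ℂ)) : ι → Series n d (HV n d) :=
  fun j Q h => (H j Q h, fun i => if Q = Pi.single i 1 then 1 else 0)

theorem part_snd_mapOfIntegral (H : ι → Series n d (Fin n → ℂ)) (j : ι) (q : ℕ)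
    (h : Fin n → ℂ) (v : Fin d → ℂ) :
    ((mapOfIntegral H j).part q h v).2 = if q = 1 then v else 0 := by
  funext i
  rw [Series.snd_part]
  simp only [mapOfIntegral, Series.part, Finset.sum_apply, Pi.smul_apply,
    smul_eq_mul, mul_ite, mul_one, mul_zero, Finset.sum_ite_eq', Finset.mem_piAntidiag]
  have hs : (Finset.univ.sum (Pi.single i 1 : Fin d → ℕ)) = 1 := by
    simp [Finset.sum_pi_single']
  have hp : ∏ x, v x ^ (Pi.single i 1 : Fin d → ℕ) x = v i := by
    rw [Finset.prod_eq_single i (fun b _ hb => by simp [hb]) (by simp)]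
    simp
  rw [hs, hp]
  by_cases hq : q = 1
  · simp [hq]
  · simp [hq, Ne.symm hq]

theorem mapOfIntegral_mem {H : ι → Series n d (Fin n → ℂ)}
    (hH : ∀ j Q, AnalyticOnNhd ℂ (H j Q) (U.img j))
    (hH1 : ∀ j, ∀ h ∈ U.img j, H j 0 h = h ∧ ∀ v, (H j).part 1 h v = 0) :
    mapOfIntegral H ∈ T.formalMaps := by
  refine ⟨fun j Q q hq => (hH j Q q hq).prod analyticAt_const, fun j h hh => ⟨?_, fun v => ?_⟩⟩
  · have h2 := part_snd_mapOfIntegral H j 0 h 0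
    rw [Series.part_zero_eq, if_neg zero_ne_one] at h2
    exact Prod.ext (hH1 j h hh).1 h2
  · refine Prod.ext ?_ ?_
    · rw [Series.fst_part]
      exact (hH1 j h hh).2 v
    · rw [part_snd_mapOfIntegral, if_pos rfl]

/-- The identity, as a formal map. -/
def idMap (n d : ℕ) (ι : Type*) : ι → Series n d (HV n d) :=
  mapOfIntegral fun _ Q h => if Q = 0 then h else 0

theorem part_idMap (j : ι) {q : ℕ} (hq : 2 ≤ q) (h : Fin n → ℂ) (v : Fin d → ℂ) :
    (idMap n d ι j).part q h v = 0 := by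
  refine Prod.ext ?_ ?_
  · rw [Series.fst_part]
    refine Finset.sum_eq_zero fun Q hQ => ?_
    have hQ' : ∑ i, Q i = q := (Finset.mem_piAntidiag.1 hQ).1
    have hQ0 : Q ≠ 0 := by
      rintro rfl
      simp at hQ'
      omega
    simp [idMap, mapOfIntegral, hQ0]
  · rw [idMap, part_snd_mapOfIntegral, if_neg (by omega)]
    rfl

theorem idMap_mem (T : TangentBundleData U d) : idMap n d ι ∈ T.formalMaps := by
  refine mapOfIntegral_mem (fun j Q q _ => ?_) fun j h _ => ⟨by simp, fun v => ?_⟩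
  · by_cases hQ : Q = 0
    · simp only [hQ, if_true]
      exact analyticAt_id
    · simpa [hQ] using analyticAt_const
  · refine Finset.sum_eq_zero fun Q hQ => ?_
    have hQ' : ∑ i, Q i = 1 := (Finset.mem_piAntidiag.1 hQ).1
    have hQ0 : Q ≠ 0 := by
      rintro rfl
      simp at hQ'
    simp only [hQ0, if_false, smul_zero]

theorem idMap_trunc (T : TangentBundleData U d) {m : ℕ} (hm : 1 ≤ m) {j : ι} {x : HV n d} (hx : x.1 ∈ U.img j) :
    (idMap n d ι j).trunc m x = x := by
  induction m, hm using Nat.le_induction with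
  | base => exact map_trunc_one (idMap_mem T) hx
  | succ m hm ih => rw [Series.trunc_succ, ih, part_idMap j (by omega), add_zero]

/-- A conjugacy to a foliated neighborhood provides first integrals, namely the horizontal
components of the conjugating map. -/
theorem admits_of_conj {Φ N : ι → ι → Series n d (HV n d)} (hN : T.IsFoliated N)
    {F : ι → Series n d (HV n d)} (hF : F ∈ T.formalMaps) (hc : ∀ m, T.ConjMod m F Φ N) :
    T.AdmitsFormalTransverseFoliation Φ := by
  refine ⟨fun j Q h => (F j Q h).1, fun j Q q hq => analyticAt_fst.fun_comp (hF.1 j Q q hq),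
    fun j h hh => ⟨?_, fun v => ?_⟩, fun k j p hp m => ?_⟩
  · simp only [(hF.2 j h hh).1]
  · rw [← Series.fst_part, (hF.2 j h hh).2]
  · have e := (hc m k j p hp).fst_comp
    simp only [← Series.fst_trunc]
    refine e.trans (EqNear.of_eventuallyEq ?_)
    filter_upwards [(map_preserves hF (Cover.mem_img_of_mem_dom hp) m).tendsto.eventually
      (eventually_fst_mem (U.isOpen_dom k j) hp)] with x hx
    exact hN.fst_trunc m hx

/-! ### Combinations of the basis cocycles -/

/-- In a split situation, a cocycle without horizontal components is a combination of the basis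
cocycles modulo the coboundary of a cochain without horizontal components. -/
theorem CohomologyBasis.exists_vertical_decomposition (b : T.CohomologyBasis)
    (hl : ∀ k j, ∀ h ∈ U.dom k j, T.l k j h = 0) {m : ℕ} (hm : 2 ≤ m)
    {ψ : Cochain n d ι} (hψ : ψ ∈ T.Z1 m)
    (hv : ∀ k j, ∀ h ∈ U.dom k j, ∀ v, ((ψ k j).part m h v).1 = 0) :
    ∃ (a : Fin (b.dim m) → ℂ) (f : ι → Series n d (HV n d)),
      (∀ j Q, ∑ i, Q i = m → AnalyticOnNhd ℂ (f j Q) (U.img j)) ∧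
      (∀ j Q h, (f j Q h).1 = 0) ∧
      ∀ k j, ∀ h ∈ U.dom k j, ∀ v,
        (ψ k j).part m h v = ∑ i, a i • ((b.e m i).1 k j).part m h v
          + (T.g k j h ((f j).part m h v)
            - (f k).part m (U.φ k j h) ((T.t k j h).mulVec v)) := by
  classical
  have hspan : ((T.B1 m).submoduleOf (T.Z1 m)).mkQ ⟨ψ, hψ⟩ ∈ Submodule.span ℂ
      (Set.range fun i => ((T.B1 m).submoduleOf (T.Z1 m)).mkQ (b.e m i)) := by
    rw [b.span_eq_top m hm]
    trivial
  obtain ⟨a, ha⟩ := (Submodule.mem_span_range_iff_exists_fun ℂ).1 hspan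
  have hB : (ψ - ∑ i, a i • (b.e m i).1) ∈ T.B1 m := by
    have h1 : ((T.B1 m).submoduleOf (T.Z1 m)).mkQ (⟨ψ, hψ⟩ - ∑ i, a i • b.e m i) = 0 := by
      rw [map_sub, map_sum, sub_eq_zero, ← ha]
      simp
    rw [Submodule.mkQ_apply, Submodule.Quotient.mk_eq_zero, Submodule.submoduleOf,
      Submodule.mem_comap] at h1
    simpa using h1
  obtain ⟨f, hf, hfψ⟩ := hB
  have hψeq : ∀ k j, ∀ h ∈ U.dom k j, ∀ v,
      (ψ k j).part m h v = ∑ i, a i • ((b.e m i).1 k j).part m h v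
        + (T.g k j h ((f j).part m h v)
          - (f k).part m (U.φ k j h) ((T.t k j h).mulVec v)) := by
    intro k j h hh v
    rw [← hfψ k j h hh v]
    simp only [Series.part, Pi.sub_apply, Finset.sum_apply, Pi.smul_apply, smul_sub,
      Finset.sum_sub_distrib, Finset.smul_sum]
    rw [Finset.sum_comm]
    simp only [smul_comm (a _)]
    abel
  -- discard the basis cocycles with values in `TC` and the horizontal part of `f`
  let vert : Fin (b.dim m) → Prop := fun i =>
    ∀ k j, ∀ h ∈ U.dom k j, ∀ v, (((b.e m i).1 k j).part m h v).1 = 0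
  refine ⟨fun i => if vert i then a i else 0, fun j Q h => (0, (f j Q h).2),
    fun j Q hQ q hq => analyticAt_const.prod (analyticAt_snd.fun_comp (hf j Q hQ q hq)),
    fun _ _ _ => rfl, fun k j h hh v => ?_⟩
  have hfv : ∀ j h v, Series.part (fun Q h => ((0, (f j Q h).2) : HV n d)) m h v
      = (0, ((f j).part m h v).2) := fun j h v => by
    refine Prod.ext ?_ ?_
    · rw [Series.fst_part]
      simp [Series.part]
    · rw [Series.snd_part, Series.snd_part]
  refine Prod.ext ?_ ?_
  · rw [hv k j h hh v, hfv, hfv]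
    simp only [Prod.fst_add, Prod.fst_sum, Prod.fst_sub, Prod.smul_fst, g, LinearMap.coe_mk,
      AddHom.coe_mk, map_zero, hl k j h hh, Matrix.zero_mulVec, add_zero, sub_zero]
    refine (Finset.sum_eq_zero fun i _ => ?_).symm
    by_cases hi : vert i
    · rw [hi k j h hh v, smul_zero]
    · rw [if_neg hi, zero_smul]
  · rw [hψeq k j h hh v, hfv, hfv]
    simp only [Prod.snd_add, Prod.snd_sum, Prod.snd_sub, Prod.smul_snd, g, LinearMap.coe_mk,
      AddHom.coe_mk]
    congr 1
    refine Finset.sum_congr rfl fun i _ => ?_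
    by_cases hi : vert i
    · rw [if_pos hi]
    · rw [((b.adapted hl m hm i).resolve_right hi) k j h hh v, smul_zero, smul_zero]

theorem CohomologyBasis.shift_analytic (b : T.CohomologyBasis) {m : ℕ}
    {Φ : ι → ι → Series n d (HV n d)}
    (hΦ : ∀ k j Q, AnalyticOnNhd ℂ (Φ k j Q) (U.dom k j)) (a : Fin (b.dim m) → ℂ) (k j : ι)
    (Q : Fin d → ℕ) : AnalyticOnNhd ℂ (b.shift m Φ a k j Q) (U.dom k j) := by
  intro q hq
  refine (hΦ k j Q q hq).add ?_
  split_ifs with hQ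
  · exact Finset.analyticAt_fun_sum _ fun i _ => analyticAt_const.fun_smul ((b.e m i).2.1 k j Q hQ q hq)
  · exact analyticAt_const

theorem CohomologyBasis.eqMod_shift (b : T.CohomologyBasis) (m : ℕ)
    (Φ : ι → ι → Series n d (HV n d)) (a : Fin (b.dim (m + 1)) → ℂ) :
    T.EqMod m Φ (b.shift (m + 1) Φ a) := fun k j Q hQ h _ => by
  rw [CohomologyBasis.shift, if_neg (by omega), add_zero]

theorem CohomologyBasis.part_sub_shift (b : T.CohomologyBasis) (m : ℕ)
    (Φ Ψ : ι → ι → Series n d (HV n d)) (a : Fin (b.dim m) → ℂ) (k j : ι) (h : Fin n → ℂ)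
    (v : Fin d → ℂ) : (Ψ k j - b.shift m Φ a k j).part m h v
      = (Ψ k j - Φ k j).part m h v - ∑ i, a i • ((b.e m i).1 k j).part m h v := by
  have h1 : (b.shift m Φ a k j).part m h v
      = (Φ k j).part m h v + ∑ i, a i • ((b.e m i).1 k j).part m h v := by
    rw [Series.part_congr (b := Φ k j + fun Q h => ∑ i, a i • (b.e m i).1 k j Q h)
      (fun Q hQ => by rw [CohomologyBasis.shift, if_pos hQ]; rfl), Series.part_add]
    congr 1
    simp only [Series.part, Finset.smul_sum]
    rw [Finset.sum_comm]
    simp only [smul_comm (a _)]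
  rw [Series.part_sub, Series.part_sub, h1, sub_sub]

/-! ### Consequences of the existence of first integrals -/

variable [IsManifold 𝓘(ℂ, Fin n → ℂ) ω C]

theorem conjMod_idMap {m : ℕ} (hm : 1 ≤ m) {A B : ι → ι → Series n d (HV n d)}
    (hA : A ∈ T.formalNbhds) (h : T.EqMod m A B) : T.ConjMod m (idMap n d ι) A B := by
  intro k j p hp
  refine EqNear.trans (EqNear.of_eventuallyEq ?_)
    ((h.eqNear hp).trans (EqNear.of_eventuallyEq ?_))
  · filter_upwards [(nbhd_preserves hA hp m).tendsto.eventually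
      (eventually_fst_mem (U.isOpen_img k) (Cover.φ_mem_img hp))] with x hx
    exact idMap_trunc T hm hx
  · filter_upwards [eventually_fst_mem (U.isOpen_img j) (Cover.mem_img_of_mem_dom hp)]
      with x hx
    rw [idMap_trunc T hm hx]

/-- The conjugate of `Φ` by a map whose horizontal components are first integrals is foliated. -/
theorem isFoliated_of_conj {H : ι → Series n d (Fin n → ℂ)} {F : ι → Series n d (HV n d)}
    (hF : F ∈ T.formalMaps) (hFH : ∀ j Q h, (F j Q h).1 = H j Q h)
    {Φ Ψ : ι → ι → Series n d (HV n d)} (hΨ : Ψ ∈ T.formalNbhds)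
    (hc : ∀ m, T.ConjMod m F Φ Ψ)
    (hH : ∀ k j, ∀ p ∈ U.dom k j, ∀ m, EqNear m p
      (fun x => (H k).trunc m ((Φ k j).trunc m x)) fun x => U.φ k j ((H j).trunc m x)) :
    T.IsFoliated Ψ := by
  have hFH' : ∀ j m x, ((F j).trunc m x).1 = (H j).trunc m x := fun j m x => by
    rw [Series.fst_trunc]
    exact Series.trunc_congr fun Q _ => hFH j Q x.1
  have key : ∀ k j, ∀ p ∈ U.dom k j, ∀ m, 1 ≤ m →
      EqNear m p (fun x => ((Ψ k j).trunc m x).1) fun x => U.φ k j x.1 := by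
    intro k j p hp m hm
    have hpj := Cover.mem_img_of_mem_dom hp
    have hφ : AnalyticAt ℂ (fun x : HV n d => U.φ k j x.1) (p, 0) :=
      AnalyticAt.fun_comp (g := U.φ k j) (Cover.analyticAt_φ hp) analyticAt_fst
    refine Series.eqNear_of_comp ?_ hφ (map_eqNear_one hF hpj hm) ?_
    · exact analyticAt_fst.fun_comp (analyticAt_nbhd hΨ m (x := (p, 0)) hp)
    · have e1 := (hc m k j p hp).fst_comp
      have e2 := hH k j p hp m
      simp only [hFH'] at e1 ⊢
      exact e1.symm.trans e2
  intro k j p hp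
  refine ⟨by rw [(hΨ.2.1 k j p hp).1], fun Q hQ => ?_⟩
  set a : Series n d (Fin n → ℂ) := fun Q h => (Ψ k j Q h).1
  set b : Series n d (Fin n → ℂ) := fun Q h => if Q = 0 then U.φ k j h else 0
  have hb : ∀ m x, b.trunc m x = U.φ k j x.1 := by
    intro m x
    induction m with
    | zero => simp [Series.trunc_zero_eq, b]
    | succ m ih =>
      rw [Series.trunc_succ, ih, add_eq_left]
      refine Finset.sum_eq_zero fun Q hQ => ?_
      have hQ' : ∑ i, Q i = m + 1 := (Finset.mem_piAntidiag.1 hQ).1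
      rw [show b Q x.1 = 0 from if_neg (by rintro rfl; simp at hQ'), smul_zero]
  have hm : 1 ≤ ∑ i, Q i := by
    refine Nat.one_le_iff_ne_zero.2 fun h0 => hQ (funext fun i => ?_)
    exact Finset.sum_eq_zero_iff.1 h0 i (Finset.mem_univ i)
  have := Series.coeff_eq_of_eqNear (a := a) (b := b) (m := ∑ i, Q i)
    (fun Q => analyticAt_fst.fun_comp (hΨ.1 k j Q p hp)) (fun Q => ?_) ?_ le_rfl
  · exact this.trans (if_neg hQ)
  · by_cases hQ0 : Q = 0
    · simpa [b, hQ0] using Cover.analyticAt_φ hp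
    · simpa [b, hQ0] using analyticAt_const
  · have := key k j p hp _ hm
    simp only [Series.fst_trunc] at this
    refine this.trans (EqNear.of_eventuallyEq (.of_forall fun x => (hb _ x).symm))

/-- The existence of first integrals forces the extension `T_C M` to be split. -/
theorem l_eq_zero {H : ι → Series n d (Fin n → ℂ)}
    (hH1 : ∀ j, ∀ h ∈ U.img j, H j 0 h = h ∧ ∀ v, (H j).part 1 h v = 0)
    {Φ : ι → ι → Series n d (HV n d)} (hΦ : Φ ∈ T.formalNbhds)
    (hH : ∀ k j, ∀ p ∈ U.dom k j, ∀ m, EqNear m p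
      (fun x => (H k).trunc m ((Φ k j).trunc m x)) fun x => U.φ k j ((H j).trunc m x)) :
    ∀ k j, ∀ h ∈ U.dom k j, T.l k j h = 0 := by
  intro k j p hp
  have hH1' : ∀ j (x : HV n d), x.1 ∈ U.img j → (H j).trunc 1 x = x.1 := fun j x hx => by
    rw [Series.trunc_succ, Series.trunc_zero_eq, (hH1 j _ hx).1, (hH1 j _ hx).2, add_zero]
  have h2 : Vanishes 2 p fun x : HV n d => (T.l k j x.1).mulVec x.2 := by
    refine (eqNear_def.1 (hH k j p hp 1)).congr' ?_
    filter_upwards [(nbhd_preserves hΦ hp 1).tendsto.eventually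
      (eventually_fst_mem (U.isOpen_img k) (Cover.φ_mem_img hp)),
      eventually_fst_mem (U.isOpen_dom k j) hp] with x hx hx'
    rw [hH1' k _ hx, hH1' j x (Cover.mem_img_of_mem_dom hx'), trunc_one_of_mem hΦ hx']
    simp
  have h3 := Series.eq_zero_of_homogeneous (m := 1) (p := p)
    (P := fun x : HV n d => (T.l k j x.1).mulVec x.2) (fun c v => by simp [Matrix.mulVec_smul]) h2
  ext a i
  simpa using congrFun (h3 (Pi.single i 1)) a

/-! ### Order by order normalization -/

/-- A chosen normal form that agrees to its order with a foliated neighborhood is foliated; the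
automorphism that the choice of the normal forms allows for may be taken to be the identity. -/
theorem NormalForms.isFoliated_of_eqMod {b : T.CohomologyBasis}
    {𝓜 : Set (ι → ι → Series n d (HV n d))} (S : NormalForms b 𝓜) {m : ℕ} {c : b.Coeff}
    (hm : 1 ≤ m) (hc : S.Adm m c) (hN : S.N m c ∈ T.formalNbhds)
    {Ψ : ι → ι → Series n d (HV n d)} (hΨ : Ψ ∈ T.formalNbhds) (hΨf : T.IsFoliated Ψ)
    (h : T.EqMod m (S.N m c) Ψ) : T.IsFoliated (S.N m c) :=
  S.foliated m c hm hc ⟨Ψ, hΨ, hΨf, idMap n d ι,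
    ⟨idMap_mem T, conjMod_idMap hm hN fun _ _ _ _ _ _ => rfl⟩, conjMod_idMap hm hN h⟩

/-- A neighborhood with first integrals `H` is conjugate to a foliated partial normal form, to any
order, by a formal map whose horizontal components are the functions `H`. -/
theorem NormalForms.exists_foliated {b : T.CohomologyBasis}
    {𝓜 : Set (ι → ι → Series n d (HV n d))}
    (h𝓜 : 𝓜 = T.holNbhds ∨ 𝓜 = T.formalNbhds) (S : NormalForms b 𝓜)
    {Φ : ι → ι → Series n d (HV n d)} (hΦ : Φ ∈ 𝓜) {H : ι → Series n d (Fin n → ℂ)}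
    (hHan : ∀ j Q, AnalyticOnNhd ℂ (H j Q) (U.img j))
    (hH1 : ∀ j, ∀ h ∈ U.img j, H j 0 h = h ∧ ∀ v, (H j).part 1 h v = 0)
    (hH : ∀ k j, ∀ p ∈ U.dom k j, ∀ m, EqNear m p
      (fun x => (H k).trunc m ((Φ k j).trunc m x)) fun x => U.φ k j ((H j).trunc m x))
    {m : ℕ} (hm : 1 ≤ m) :
    ∃ F ∈ T.formalMaps, (∀ j Q h, (F j Q h).1 = H j Q h) ∧ ∃ c : b.Coeff,
      S.Adm m c ∧ T.ConjMod m F Φ (S.N m c) ∧ T.IsFoliated (S.N m c) := by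
  have hsub : 𝓜 ⊆ T.formalNbhds := by
    rcases h𝓜 with rfl | rfl
    exacts [fun _ h => h.1, subset_rfl]
  have hΦ' := hsub hΦ
  have hl := l_eq_zero hH1 hΦ' hH
  induction m, hm using Nat.le_induction with
  | base =>
    have hF : mapOfIntegral H ∈ T.formalMaps := mapOfIntegral_mem hHan hH1
    obtain ⟨Ψ, hΨ, hc⟩ := exists_conj hF hΦ'
    have hΨf := isFoliated_of_conj hF (fun _ _ _ => rfl) hΨ hc hH
    have hN := hsub (S.mem 1 0 le_rfl (S.adm_one 0))
    exact ⟨_, hF, fun _ _ _ => rfl, 0, S.adm_one 0,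
      (EqMod.eqMod_one hΨ hN).conjMod hF (hc 1),
      S.isFoliated_of_eqMod le_rfl (S.adm_one 0) hN hΨ hΨf (EqMod.eqMod_one hN hΨ)⟩
  | succ m hm ih =>
    obtain ⟨F, hF, hFH, c, hcA, hcF, hNf⟩ := ih
    have hN := hsub (S.mem m c hm hcA)
    -- the foliated conjugate `Ψ` differs from `N^m(c)` by a cocycle with values in `N_C`
    obtain ⟨Ψ, hΨ, hΨc⟩ := exists_conj hF hΦ'
    have hΨf := isFoliated_of_conj hF hFH hΨ hΨc hH
    have hΨN : T.EqMod m Ψ (S.N m c) := (hΨc m).eqMod hm hF hΨ.1 hN.1 hcF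
    have hv : ∀ k j, ∀ h ∈ U.dom k j, ∀ v,
        ((Series.part ((Ψ - S.N m c) k j) (m + 1) h v)).1 = 0 := by
      intro k j h hh v
      rw [Series.fst_part]
      refine Finset.sum_eq_zero fun Q hQ => ?_
      have hQ' : ∑ i, Q i = m + 1 := (Finset.mem_piAntidiag.1 hQ).1
      have hQ0 : Q ≠ 0 := by
        rintro rfl
        simp at hQ'
      simp [(hΨf k j h hh).2 Q hQ0, (hNf k j h hh).2 Q hQ0]
    obtain ⟨a, f, hf, hfv, hdec⟩ := b.exists_vertical_decomposition hl (m := m + 1) (by omega)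
      (sub_mem_Z1 hm hΨ hN hΨN) hv
    have hF' := addPart_mem (m := m + 1) (by omega) hF hf
    have hF'H : ∀ j Q h, (addPart (m + 1) F f j Q h).1 = H j Q h := by
      intro j Q h
      rw [addPart, Prod.fst_add, hFH]
      split_ifs <;> simp [hfv]
    have hsh := b.shift_analytic hN.1 a
    have hconj : T.ConjMod (m + 1) (addPart (m + 1) F f) Φ (b.shift (m + 1) (S.N m c) a) := by
      refine conjMod_addPart hm hΦ' hΨ hsh hF (hΨc (m + 1))
        (hΨN.trans (b.eqMod_shift m _ a)) hf fun k j h hh v => ?_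
      rw [b.part_sub_shift, sub_eq_iff_eq_add', ← hdec k j h hh v]
      rfl
    -- a member of `𝓜` with the same jet of order `m + 1`, and its normal form
    obtain ⟨Θ, hΘ, hΘc⟩ := exists_conj_mem h𝓜 (m := m + 1) (by omega) hF' hΦ
    have hΘN : T.EqMod (m + 1) Θ (b.shift (m + 1) (S.N m c) a) :=
      hΘc.eqMod (by omega) hF' (hsub hΘ).1 hsh hconj
    obtain ⟨a', ⟨hA', G, hG, hGc⟩, -⟩ := S.represents m c hm hcA Θ ⟨hΘ, a, hΘN⟩
    set c' := Function.update c (m + 1) a'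
    have hcc' : S.N m c' = S.N m c := (S.congr m c' c fun q _ hq => by
      simp only [c']
      rw [Function.update_of_ne (by omega)]).2
    have hN' := hsub (S.mem (m + 1) c' (by omega) hA')
    have hN'N : T.EqMod m (S.N (m + 1) c') (S.N m c) := by
      have h1 := (S.step m c' hm hA').mono (Nat.le_succ m)
      rw [hcc'] at h1
      exact h1.trans (b.eqMod_shift m _ _).symm
    have hΘN' : T.EqMod (m + 1) Θ (S.N (m + 1) c') :=
      eqMod_of_aut hm (hsub hΘ) hN' hN ((hΘN.mono (Nat.le_succ m)).trans
        (b.eqMod_shift m _ a).symm) hN'N hG hGc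
    obtain ⟨Ψ', hΨ', hΨ'c⟩ := exists_conj hF' hΦ'
    have hΨ'f := isFoliated_of_conj hF' hF'H hΨ' hΨ'c hH
    have hΘΨ' : T.EqMod (m + 1) Θ Ψ' :=
      hΘc.eqMod (by omega) hF' (hsub hΘ).1 hΨ'.1 (hΨ'c (m + 1))
    exact ⟨_, hF', hF'H, c', hA', hΘN'.conjMod hF' hΘc,
      S.isFoliated_of_eqMod (by omega) hA' hN' hΨ' hΨ'f (hΘN'.symm.trans hΘΨ')⟩

/-- When the obstruction space vanishes, a conjugacy to order `m` can be improved by a change of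
the formal map in degree `m + 1`. -/
theorem exists_conjMod_succ {m : ℕ} (hm : 1 ≤ m) [Subsingleton (T.H1 (m + 1))]
    {Φ N : ι → ι → Series n d (HV n d)} (hΦ : Φ ∈ T.formalNbhds) (hN : N ∈ T.formalNbhds)
    {F : ι → Series n d (HV n d)} (hF : F ∈ T.formalMaps) (hc : T.ConjMod m F Φ N) :
    ∃ F' ∈ T.formalMaps, T.ConjMod (m + 1) F' Φ N ∧
      ∀ j Q, ∑ i, Q i ≤ m → F' j Q = F j Q := by
  obtain ⟨Ψ, hΨ, hΨc⟩ := exists_conj hF hΦ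
  have hΨN : T.EqMod m Ψ N := (hΨc m).eqMod hm hF hΨ.1 hN.1 hc
  have hZ := sub_mem_Z1 hm hΨ hN hΨN
  have h0 : ((T.B1 (m + 1)).submoduleOf (T.Z1 (m + 1))).mkQ ⟨Ψ - N, hZ⟩ = 0 :=
    Subsingleton.elim (α := T.H1 (m + 1)) _ _
  rw [Submodule.mkQ_apply, Submodule.Quotient.mk_eq_zero, Submodule.submoduleOf,
    Submodule.mem_comap] at h0
  obtain ⟨f, hf, hfψ⟩ := h0
  refine ⟨addPart (m + 1) F f, addPart_mem (by omega) hF hf,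
    conjMod_addPart hm hΦ hΨ hN.1 hF (hΨc (m + 1)) hΨN hf hfψ, fun j Q hQ => ?_⟩
  funext h
  rw [addPart, if_neg (by omega), add_zero]

/-- If the obstruction spaces of all degrees above `ℓ` vanish, a conjugacy to order `ℓ` can be
improved to a conjugacy to all orders. -/
theorem exists_conj_of_subsingleton {ℓ : ℕ} (hℓ : 1 ≤ ℓ)
    (hH1 : ∀ m, ℓ < m → Subsingleton (T.H1 m))
    {Φ N : ι → ι → Series n d (HV n d)} (hΦ : Φ ∈ T.formalNbhds) (hN : N ∈ T.formalNbhds)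
    {F : ι → Series n d (HV n d)} (hF : F ∈ T.formalMaps) (hc : T.ConjMod ℓ F Φ N) :
    ∃ F' ∈ T.formalMaps, ∀ m, T.ConjMod m F' Φ N := by
  have hstep : ∀ (m : ℕ) (G : {G // G ∈ T.formalMaps ∧ T.ConjMod (ℓ + m) G Φ N}),
      ∃ G' : {G // G ∈ T.formalMaps ∧ T.ConjMod (ℓ + (m + 1)) G Φ N},
        ∀ j Q, ∑ i, Q i ≤ ℓ + m → G'.1 j Q = G.1 j Q := by
    rintro m ⟨G, hG, hGc⟩
    have := hH1 (ℓ + m + 1) (by omega)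
    obtain ⟨G', hG', hGc', hGG⟩ := exists_conjMod_succ (m := ℓ + m) (by omega) hΦ hN hG hGc
    exact ⟨⟨G', hG', hGc'⟩, hGG⟩
  choose next hnext using hstep
  let seq : ∀ m, {G // G ∈ T.formalMaps ∧ T.ConjMod (ℓ + m) G Φ N} := fun m =>
    Nat.rec ⟨F, hF, hc⟩ next m
  have hseq : ∀ m k, m ≤ k → ∀ j Q, ∑ i, Q i ≤ ℓ + m → (seq k).1 j Q = (seq m).1 j Q := by
    intro m k hk j Q hQ
    induction k, hk using Nat.le_induction with
    | base => rfl
    | succ k hk ih => rw [← ih]; exact hnext k (seq k) j Q (by omega)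
  -- the coefficients of the sequence of maps become stationary
  let F' : ι → Series n d (HV n d) := fun j Q => (seq (∑ i, Q i)).1 j Q
  have hF'eq : ∀ m j Q, ∑ i, Q i ≤ m → F' j Q = (seq m).1 j Q := fun m j Q hQ =>
    (hseq _ m hQ j Q (by omega)).symm
  have hF' : F' ∈ T.formalMaps := by
    refine ⟨fun j Q => (seq _).2.1.1 j Q, fun j h hh => ⟨?_, fun v => ?_⟩⟩
    · rw [hF'eq 0 j 0 (by simp)]
      exact ((seq 0).2.1.2 j h hh).1
    · rw [Series.part_congr (b := (seq 1).1 j) fun Q hQ => by rw [hF'eq 1 j Q hQ.le]]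
      exact ((seq 1).2.1.2 j h hh).2 v
  refine ⟨F', hF', fun m k j p hp => ?_⟩
  have ht : ∀ j, (F' j).trunc m = ((seq m).1 j).trunc m := fun j =>
    funext fun x => Series.trunc_congr fun Q hQ => by rw [hF'eq m j Q hQ]
  rw [ht k, ht j]
  exact (seq m).2.2.mono (seq m).2.1 hΦ hN.1 (Nat.le_add_left m ℓ) k j p hp

end TangentBundleData

end TransFol

theorem mainTheorem9 {n d : ℕ} {C : Type*} [TopologicalSpace C] [T2Space C] [CompactSpace C]
    [ChartedSpace (Fin n → ℂ) C] [IsManifold 𝓘(ℂ, Fin n → ℂ) ω C] {ι : Type*} [Finite ι]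
    (U : TransFol.Cover n C ι) (T : TransFol.TangentBundleData U d)
    (𝓜 : Set (ι → ι → TransFol.Series n d (TransFol.HV n d)))
    (h𝓜 : 𝓜 = T.holNbhds ∨ 𝓜 = T.formalNbhds)
    (b : T.CohomologyBasis) (S : TransFol.TangentBundleData.NormalForms b 𝓜)
    (ℓ₀ : ℕ) (hℓ₀ : 1 < ℓ₀) (hH1 : ∀ ℓ, ℓ₀ < ℓ → Subsingleton (T.H1 ℓ))
    (Φ : ι → ι → TransFol.Series n d (TransFol.HV n d)) (hΦ : Φ ∈ 𝓜) :
    T.AdmitsFormalTransverseFoliation Φ ↔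
      ∃ F ∈ T.formalMaps, ∃ c : b.Coeff,
        S.Adm ℓ₀ c ∧ T.ConjMod ℓ₀ F Φ (S.N ℓ₀ c) ∧ T.IsFoliated (S.N ℓ₀ c) := by
  constructor
  · rintro ⟨H, hHan, hH1', hH⟩
    obtain ⟨F, hF, -, c, h⟩ := S.exists_foliated h𝓜 hΦ hHan hH1' hH hℓ₀.le
    exact ⟨F, hF, c, h⟩
  · rintro ⟨F, hF, c, hA, hc, hf⟩
    have hsub : 𝓜 ⊆ T.formalNbhds := by
      rcases h𝓜 with rfl | rfl
      exacts [fun _ h => h.1, subset_rfl]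
    obtain ⟨F', hF', hc'⟩ := TransFol.TangentBundleData.exists_conj_of_subsingleton hℓ₀.le hH1
      (hsub hΦ) (hsub (S.mem ℓ₀ c hℓ₀.le hA)) hF hc
    exact TransFol.TangentBundleData.admits_of_conj hf hF' hc'
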